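/- Theories are first-order theories with identity in finite relational signatures; a many-sorted theory is identified with the one-sorted theory having an additional unary predicate for each sort, together with axioms saying that the sorts cover the domain, are pairwise disjoint and non-empty, and that each predicate holds only of arguments of the right sorts. An interpretation is a relative interpretation, of some dimension $m\ge 1$, with parameters and with definable identity. For theories $T,U$ let $T\sqcup U$ be the two-sorted theory with the predicates and (relativized) axioms of $T$ on the first sort and those of $U$ on the second sort; here $\forall x\,(x=x)$ stands for the theory with this axiom in the language with identity only. For a theory $T$ and $n\ge 0$ let $\mathsf{AC}_{\le n}(T)$ be the theory with sorts $\mathfrak o$ (objects) and $\mathfrak c_1,\dots,\mathfrak c_n$ ($k$-ary classes, $1\le k\le n$), whose predicates are those of $T$ on $\mathfrak o$ and $\langle x_1,\dots,x_k\rangle\in X$ for $x_1,\dots,x_k$ of sort $\mathfrak o$, $X$ of sort $\mathfrak c_k$, $1\le k\le n$, and whose axioms are those of $T$ relativized to $\mathfrak o$ and, for $1\le k\le n$, $$\exists X^{\mathfrak c_k}\,\forall x_1^{\mathfrak o},\dots,x_k^{\mathfrak o}\;\neg\,\langle x_1,\dots,x_k\rangle\in X,$$ $$\forall X^{\mathfrak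 c_k},x_1^{\mathfrak o},\dots,x_k^{\mathfrak o}\,\exists Y^{\mathfrak c_k}\,\forall y_1^{\mathfrak o},\dots,y_k^{\mathfrak o}\,\Big(\langle y_1,\dots,y_k\rangle\in Y\leftrightarrow\big(\langle y_1,\dots,y_k\rangle\in X\lor\bigwedge_{1\le i\le k}y_i=x_i\big)\Big).$$ Let $\mathsf{AS}(T)$ be the extension of $T$ by a fresh binary predicate $\in$ and the axioms $\exists x\,\forall y\,\neg\,y\in x$ and $\forall x,y\,\exists z\,\forall w\,(w\in z\leftrightarrow(w\in x\lor w=y))$. For a theory $U$ let $\mathsf{KM}(U)$ be the two-sorted theory of Kripke models of $U$: its sorts are worlds and elements; its predicates are $p\preceq q$ on worlds, $D(p,x)$, and $R^\star(p,x_1,\dots,x_k)$ for each $k$-ary predicate $R$ of $U$, identity included ($p,q$ worlds, $x,x_i$ elements). Put $p\Vdash R(\vec x)$ for $(\forall q\preceq p)(\exists r\preceq q)R^\star(r,\vec x)$; $p\Vdash\varphi\land\psi$ for $(p\Vdash\varphi)\land(p\Vdash\psi)$; $p\Vdash\neg\varphi$ for $(\forall q\preceq p)\neg(q\Vdash\varphi)$;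 $p\Vdash\forall y\,\varphi$ for $(\forall q\preceq p)\forall y\,(D(q,y)\to q\Vdash\varphi)$. The axioms of $\mathsf{KM}(U)$ say that $\preceq$ is reflexive and transitive, that $\forall p\,\exists x\,D(p,x)$, that $q\preceq p$ and $D(p,x)$ imply $D(q,x)$, that $R^\star(p,\vec x)$ implies $D(p,x_i)$ for all $i$, that $q\preceq p$ and $R^\star(p,\vec x)$ imply $R^\star(q,\vec x)$, and that $\forall p\;p\Vdash\varphi$ for every axiom $\varphi$ of $U$, the identity axioms included. A theory $V$ forcing-interprets $U$ if there is an interpretation of $\mathsf{KM}(U)$ in $V$. Theorem. Suppose that $T$ is a finitely axiomatized theory that one-dimensionally interprets $T\sqcup\forall x\,(x=x)$. Then, for all sufficiently large $n$, the theory $\mathsf{AC}_{\le n}(T)$ forcing-interprets $\mathsf{AS}(T)$. -/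

import Mathlib

universe u v u' v' w

noncomputable section

namespace ForcingAS

open FirstOrder FirstOrder.Language

/-! ### Formulas of relational languages -/

section Formulas

variable {L : FirstOrder.Language.{u, v}} {L' : FirstOrder.Language.{u', v'}} {α : Type w}

/-- In a relational language every term is a variable. -/
def varOf [L.IsRelational] : L.Term α → α
  | .var a => a
  | .func f _ => isEmptyElim f

/-- The language map induced by a map of predicate symbols, out of a relational language. -/
def relHom [L.IsRelational] (f : ∀ k, L.Relations k → L'.Relations k) : L →ᴸ L' where
  onFunction := fun _ F => isEmptyElim F
  onRelation := fun k R => f k R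

/-- Relativization of all quantifiers of a formula to the unary predicate `s`. -/
def relativize (s : L.Relations 1) : ∀ {n : ℕ}, L.BoundedFormula α n → L.BoundedFormula α n
  | _, .falsum => .falsum
  | _, .equal t₁ t₂ => .equal t₁ t₂
  | _, .rel R ts => .rel R ts
  | _, .imp f g => (relativize s f).imp (relativize s g)
  | n, .all f =>
      ((s.boundedFormula₁ (Term.var (Sum.inr (Fin.last n)))).imp (relativize s f)).all

/-- `∀ x_b (b : β)` with all the quantified variables of sort `s`. -/
def allS (s : L.Relations 1) {β : Type} [Finite β] (φ : L.Formula (α ⊕ β)) : L.Formula α :=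
  Formula.iAlls β
    ((Formula.iInf fun b : β => s.formula₁ (Term.var (Sum.inr b))).imp φ)

/-- `∃ x_b (b : β)` with all the quantified variables of sort `s`. -/
def exS (s : L.Relations 1) {β : Type} [Finite β] (φ : L.Formula (α ⊕ β)) : L.Formula α :=
  Formula.iExs β
    ((Formula.iInf fun b : β => s.formula₁ (Term.var (Sum.inr b))) ⊓ φ)

variable (L) in
/-- The axioms of identity: identity is an equivalence relation which is a congruence
with respect to every predicate symbol. -/
inductive EqAxiom : L.Sentence → Prop
  | refl : EqAxiom (∀' (&0 =' &0))
  | symm : EqAxiom (∀' ∀' ((&0 =' &1) ⟹ (&1 =' &0)))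
  | trans : EqAxiom (∀' ∀' ∀' ((&0 =' &1) ⟹ ((&1 =' &2) ⟹ (&0 =' &2))))
  | congr {k : ℕ} (R : L.Relations k) :
      EqAxiom (Formula.iAlls (Fin 2 × Fin k)
        ((Formula.iInf fun i : Fin k =>
            Term.equal (Term.var (Sum.inr (0, i))) (Term.var (Sum.inr (1, i)))).imp
          ((R.formula fun i => Term.var (Sum.inr (0, i))).imp
            (R.formula fun i => Term.var (Sum.inr (1, i))))))

end Formulas

/-! ### Many-sorted theories as one-sorted theories -/

/-- A many-sorted relational signature. -/
structure SortedSig : Type (v + 1) where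
  Sorts : Type
  Rel : ℕ → Type v
  argSort : ∀ {k : ℕ}, Rel k → Fin k → Sorts

/-- Predicate symbols of the one-sorted signature of a many-sorted signature: one unary
predicate for each sort, and the original predicates. -/
inductive FlatRel (S : SortedSig.{v}) : ℕ → Type v
  | sort (s : S.Sorts) : FlatRel S 1
  | base {k : ℕ} (R : S.Rel k) : FlatRel S k

/-- The one-sorted language of a many-sorted signature. -/
def flatLang (S : SortedSig.{v}) : FirstOrder.Language.{0, v} := ⟨fun _ => Empty, FlatRel S⟩

instance (S : SortedSig.{v}) : (flatLang S).IsRelational := fun _ => inferInstanceAs (IsEmpty Empty)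

def sortP {S : SortedSig.{v}} (s : S.Sorts) : (flatLang S).Relations 1 := FlatRel.sort s

def baseP {S : SortedSig.{v}} {k : ℕ} (R : S.Rel k) : (flatLang S).Relations k := FlatRel.base R

/-- The general axioms of the one-sorted rendering of a many-sorted theory: the sorts cover
the domain, are pairwise disjoint and nonempty, and the predicates only hold of arguments of
the right sorts. -/
inductive SortAxiom (S : SortedSig.{v}) [Finite S.Sorts] : (flatLang S).Sentence → Prop
  | cover : SortAxiom S
      (∀' (BoundedFormula.iSup fun s : S.Sorts => (sortP s).boundedFormula₁ (&0)))
  | disj (s t : S.Sorts) (h : s ≠ t) : SortAxiom S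
      (∀' ∼((sortP s).boundedFormula₁ (&0) ⊓ (sortP t).boundedFormula₁ (&0)))
  | nonempty (s : S.Sorts) : SortAxiom S (∃' ((sortP s).boundedFormula₁ (&0)))
  | typed {k : ℕ} (R : S.Rel k) : SortAxiom S
      (Formula.iAlls (Fin k)
        (((baseP R).formula fun i => Term.var (Sum.inr i)).imp
          (Formula.iInf fun i : Fin k =>
            (sortP (S.argSort R i)).formula₁ (Term.var (Sum.inr i)))))

/-! ### Multi-dimensional relative interpretations with parameters and definable identity -/

/-- A translation of the language `L'` into the language `L`, of dimension `m`. Variables of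
`L'` are translated as `m`-tuples; `Fin params` are the parameters, which range over the
parameter domain `par`. -/
structure Translation (L : FirstOrder.Language.{u, v}) (L' : FirstOrder.Language.{u', v'}) (m : ℕ) where
  params : ℕ
  par : L.Formula (Fin params)
  dom : L.Formula (Fin m ⊕ Fin params)
  eq : L.Formula ((Fin 2 × Fin m) ⊕ Fin params)
  rel : ∀ {k : ℕ}, L'.Relations k → L.Formula ((Fin k × Fin m) ⊕ Fin params)

namespace Translation

variable {L : FirstOrder.Language.{u, v}} {L' : FirstOrder.Language.{u', v'}} {m : ℕ} {α : Type w}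

/-- The translation of a formula: quantifiers are relativized to the domain formula, and
identity and the predicate symbols are replaced by their translations. -/
def tr [L'.IsRelational] (τ : Translation L L' m) :
    ∀ {n : ℕ}, L'.BoundedFormula α n → L.Formula (((α ⊕ Fin n) × Fin m) ⊕ Fin τ.params)
  | _, .falsum => ⊥
  | _, .equal t₁ t₂ => τ.eq.relabel (Sum.map (Prod.map ![varOf t₁, varOf t₂] id) id)
  | _, .rel R ts => (τ.rel R).relabel (Sum.map (Prod.map (fun i => varOf (ts i)) id) id)
  | _, .imp f g => (τ.tr f).imp (τ.tr g)
  | n, .all f =>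
      Formula.iAlls (Fin m)
        ((τ.dom.relabel (Sum.elim Sum.inr (fun p => Sum.inl (Sum.inr p)))).imp
          ((τ.tr f).relabel fun x => match x with
            | .inl (.inl a, j) => .inl (.inl (.inl a, j))
            | .inl (.inr i, j) =>
                Fin.lastCases (motive := fun _ => (((α ⊕ Fin n) × Fin m) ⊕ Fin τ.params) ⊕ Fin m)
                  (.inr j) (fun i' => .inl (.inl (.inr i', j))) i
            | .inr p => .inl (.inr p)))

/-- The translation of a sentence; its only free variables are the parameters. -/
def trSentence [L'.IsRelational] (τ : Translation L L' m) (ψ : L'.Sentence) :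
    L.Formula (Fin τ.params) :=
  (τ.tr ψ).relabel (Sum.elim (fun x => isEmptyElim x.1) id)

/-- The domain is nonempty. -/
def domNonempty (τ : Translation L L' m) : L.Formula (Fin τ.params) :=
  Formula.iExs (Fin m) (τ.dom.relabel Sum.swap)

end Translation

/-- `T` interprets `U` by an `m`-dimensional relative interpretation with parameters and
definable identity: `T` proves that the parameter domain is nonempty and that, for all
parameters from it, the domain is nonempty and the translations of the identity axioms and of
the axioms of `U` hold. -/
def InterpretsDim {L : FirstOrder.Language.{u, v}} {L' : FirstOrder.Language.{u', v'}} [L'.IsRelational]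
    (m : ℕ) (T : L.Theory) (U : L'.Theory) : Prop :=
  ∃ τ : Translation L L' m,
    (T ⊨ᵇ (Formula.iExs (Fin τ.params) (τ.par.relabel Sum.inr) : L.Sentence)) ∧
    (T ⊨ᵇ τ.par.imp τ.domNonempty) ∧
    (∀ ψ, EqAxiom L' ψ → T ⊨ᵇ τ.par.imp (τ.trSentence ψ)) ∧
    (∀ ψ ∈ U, T ⊨ᵇ τ.par.imp (τ.trSentence ψ))

/-! ### The two-sorted theory `T ⊔ U` -/

section DisjointUnion

variable {L : FirstOrder.Language.{u, v}} {L' : FirstOrder.Language.{u', v'}}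

variable (L L') in
/-- Sort `0` carries the predicates of `L`, sort `1` those of `L'`. -/
def unionSig : SortedSig.{max v v'} where
  Sorts := Fin 2
  Rel k := L.Relations k ⊕ L'.Relations k
  argSort := fun R _ => match R with
    | .inl _ => 0
    | .inr _ => 1

instance : Finite (unionSig L L').Sorts := inferInstanceAs (Finite (Fin 2))

/-- The theory `T ⊔ U`: `T` relativized to the first sort and `U` relativized to the second. -/
def disjUnion [L.IsRelational] [L'.IsRelational] (T : L.Theory) (U : L'.Theory) :
    (flatLang (unionSig L L')).Theory :=
  {ψ | SortAxiom (unionSig L L') ψ} ∪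
  (fun ψ => relativize (sortP (S := unionSig L L') (0 : Fin 2))
    ((relHom fun _ R => baseP (S := unionSig L L') (Sum.inl R)).onSentence ψ)) '' T ∪
  (fun ψ => relativize (sortP (S := unionSig L L') (1 : Fin 2))
    ((relHom fun _ R => baseP (S := unionSig L L') (Sum.inr R)).onSentence ψ)) '' U

/-- The theory `∀ x (x = x)` in the language with identity only. -/
def trivialTheory : FirstOrder.Language.empty.Theory := {∀' (&0 =' &0)}

end DisjointUnion

/-! ### Adjunctive classes: `AC_{≤ n}(T)` -/

section Classes

/-- Predicates of `AC_{≤ n}(T)`. The symbol `mem i` is membership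
`⟨x₁, …, x_k⟩ ∈ X` for classes of arity `k = i + 1`; the last argument is `X`. -/
inductive ClassRel (L : FirstOrder.Language.{u, v}) (n : ℕ) : ℕ → Type v
  | base {k : ℕ} (R : L.Relations k) : ClassRel L n k
  | mem (i : Fin n) : ClassRel L n (i + 1 + 1)

/-- The sort `none` is the sort of objects and `some i` the sort of classes of arity `i + 1`. -/
def classSig (L : FirstOrder.Language.{u, v}) (n : ℕ) : SortedSig.{v} where
  Sorts := Option (Fin n)
  Rel := ClassRel L n
  argSort := fun R => match R with
    | .base _ => fun _ => none
    | .mem i => Fin.snoc (α := fun _ => Option (Fin n)) (fun _ => none) (some i)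

instance (L : FirstOrder.Language.{u, v}) (n : ℕ) : Finite (classSig L n).Sorts :=
  inferInstanceAs (Finite (Option (Fin n)))

variable (L : FirstOrder.Language.{u, v}) {n : ℕ} {α : Type w}

/-- The predicate of being an object. -/
def objP : (flatLang (classSig L n)).Relations 1 :=
  sortP (S := classSig L n) (none : Option (Fin n))

/-- The predicate of being a class of arity `i + 1`. -/
def classP (i : Fin n) : (flatLang (classSig L n)).Relations 1 :=
  sortP (S := classSig L n) (some i)

/-- The formula `⟨x₁, …, x_k⟩ ∈ X`, where `k = i + 1`. -/
def memF (i : Fin n) (x : Fin (i + 1) → α) (X : α) : (flatLang (classSig L n)).Formula α :=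
  (baseP (S := classSig L n) (ClassRel.mem i)).formula
    (fun j => Term.var (Fin.snoc (α := fun _ => α) x X j))

/-- `∃ X^(k) ∀ x₁ … x_k ¬ ⟨x₁, …, x_k⟩ ∈ X`. -/
def emptyClass (i : Fin n) : (flatLang (classSig L n)).Sentence :=
  exS (classP L i) (β := Unit) (allS (objP L) (β := Fin (i + 1))
    ∼(memF L i (fun j => Sum.inr j) (Sum.inl (Sum.inr ()))))

/-- `∀ X^(k) ∀ x₁ … x_k ∃ Y^(k) ∀ y₁ … y_k (y ∈ Y ↔ (y ∈ X ∨ y₁ = x₁ ∧ … ∧ y_k = x_k))`. -/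
def adjunctionClass (i : Fin n) : (flatLang (classSig L n)).Sentence :=
  allS (classP L i) (β := Unit) (allS (objP L) (β := Fin (i + 1))
    (exS (classP L i) (β := Unit) (allS (objP L) (β := Fin (i + 1))
      (BoundedFormula.iff
        (memF L i (fun j => Sum.inr j) (Sum.inl (Sum.inr ())))
        (memF L i (fun j => Sum.inr j) (Sum.inl (Sum.inl (Sum.inl (Sum.inr ())))) ⊔
          Formula.iInf fun j : Fin (i + 1) =>
            Term.equal (Term.var (Sum.inr j)) (Term.var (Sum.inl (Sum.inl (Sum.inr j)))))))))

variable {L} in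
/-- The theory `AC_{≤ n}(T)`. -/
def AC [L.IsRelational] (n : ℕ) (T : L.Theory) : (flatLang (classSig L n)).Theory :=
  {ψ | SortAxiom (classSig L n) ψ} ∪
  (fun ψ => relativize (objP L)
    ((relHom fun _ R => baseP (S := classSig L n) (ClassRel.base R)).onSentence ψ)) '' T ∪
  Set.range (emptyClass L (n := n)) ∪
  Set.range (adjunctionClass L (n := n))

end Classes

/-! ### Adjunctive sets: `AS(T)` -/

section Sets

/-- The predicate symbols of `L` and a fresh binary predicate symbol. -/
inductive SetRel (L : FirstOrder.Language.{u, v}) : ℕ → Type v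
  | base {k : ℕ} (R : L.Relations k) : SetRel L k
  | mem : SetRel L 2

def setLang (L : FirstOrder.Language.{u, v}) : FirstOrder.Language.{0, v} := ⟨fun _ => Empty, SetRel L⟩

instance (L : FirstOrder.Language.{u, v}) : (setLang L).IsRelational := fun _ => inferInstanceAs (IsEmpty Empty)

def memP (L : FirstOrder.Language.{u, v}) : (setLang L).Relations 2 := SetRel.mem

/-- `∃ x ∀ y ¬ y ∈ x`. -/
def emptySet (L : FirstOrder.Language.{u, v}) : (setLang L).Sentence :=
  ∃' ∀' ∼((memP L).boundedFormula₂ (&1) (&0))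

/-- `∀ x ∀ y ∃ z ∀ w (w ∈ z ↔ (w ∈ x ∨ w = y))`. -/
def adjunctionSet (L : FirstOrder.Language.{u, v}) : (setLang L).Sentence :=
  ∀' ∀' ∃' ∀' (((memP L).boundedFormula₂ (&3) (&2)) ⇔
    (((memP L).boundedFormula₂ (&3) (&0)) ⊔ (&3 =' &1)))

/-- The theory `AS(T)`. -/
def AS {L : FirstOrder.Language.{u, v}} [L.IsRelational] (T : L.Theory) : (setLang L).Theory :=
  (relHom (L' := setLang L) fun _ R => SetRel.base R).onTheory T ∪ {emptySet L, adjunctionSet L}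

end Sets

/-! ### Kripke models and forcing-interpretations -/

section Kripke

/-- The predicates of a language with identity: its predicate symbols and identity. -/
inductive PredSym (L : FirstOrder.Language.{u, v}) : ℕ → Type v
  | rel {k : ℕ} (R : L.Relations k) : PredSym L k
  | eq : PredSym L 2

/-- Predicates of `KM(T)`: the accessibility relation on worlds, the domain predicate
`D(p, x)`, and `R⋆(p, x₁, …, x_k)` for every predicate `R` (identity included). -/
inductive KripkeRel (L : FirstOrder.Language.{u, v}) : ℕ → Type v
  | le : KripkeRel L 2
  | dom : KripkeRel L 2
  | star {k : ℕ} (R : PredSym L k) : KripkeRel L (k + 1)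

/-- The sorts of `KM(T)` are `0`, the sort of worlds, and `1`, the sort of elements. -/
def kripkeSig (L : FirstOrder.Language.{u, v}) : SortedSig.{v} where
  Sorts := Fin 2
  Rel := KripkeRel L
  argSort := fun R => match R with
    | .le => fun _ => 0
    | .dom => ![0, 1]
    | .star _ => Fin.cons (α := fun _ => Fin 2) 0 (fun _ => 1)

instance (L : FirstOrder.Language.{u, v}) : Finite (kripkeSig L).Sorts := inferInstanceAs (Finite (Fin 2))

abbrev kripkeLang (L : FirstOrder.Language.{u, v}) : FirstOrder.Language.{0, v} := flatLang (kripkeSig L)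

variable (L : FirstOrder.Language.{u, v}) {α : Type w}

def worldP : (kripkeLang L).Relations 1 := sortP (S := kripkeSig L) (0 : Fin 2)

def elemP : (kripkeLang L).Relations 1 := sortP (S := kripkeSig L) (1 : Fin 2)

/-- The formula `q ≼ p`. -/
def leF (q p : α) : (kripkeLang L).Formula α :=
  Relations.formula₂ (baseP (S := kripkeSig L) KripkeRel.le) (Term.var q) (Term.var p)

/-- The formula `D(p, x)`. -/
def domF (p x : α) : (kripkeLang L).Formula α :=
  Relations.formula₂ (baseP (S := kripkeSig L) KripkeRel.dom) (Term.var p) (Term.var x)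

variable {L} in
/-- The formula `R⋆(p, x₁, …, x_k)`. -/
def starF {k : ℕ} (R : PredSym L k) (p : α) (x : Fin k → α) : (kripkeLang L).Formula α :=
  (baseP (S := kripkeSig L) (KripkeRel.star R)).formula
    (fun j => Term.var (Fin.cons (α := fun _ => α) p x j))

section Forcing

variable {L}

/-- From `φ(p, …)` the formula `(∀ q ≼ p) φ(q, …)`; the variable `inl ()` is the world. -/
def allBelow (φ : (kripkeLang L).Formula (Unit ⊕ α)) : (kripkeLang L).Formula (Unit ⊕ α) :=
  allS (worldP L) (β := Unit)
    ((leF L (Sum.inr ()) (Sum.inl (Sum.inl ()))).imp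
      (φ.relabel (Sum.elim (fun _ => Sum.inr ()) (fun a => Sum.inl (Sum.inr a)))))

/-- From `φ(p, …)` the formula `(∃ q ≼ p) φ(q, …)`; the variable `inl ()` is the world. -/
def exBelow (φ : (kripkeLang L).Formula (Unit ⊕ α)) : (kripkeLang L).Formula (Unit ⊕ α) :=
  exS (worldP L) (β := Unit)
    ((leF L (Sum.inr ()) (Sum.inl (Sum.inl ()))) ⊓
      (φ.relabel (Sum.elim (fun _ => Sum.inr ()) (fun a => Sum.inl (Sum.inr a)))))

/-- The formula `p ⊩ φ`, where `p` is the variable `inl ()`. The implication `φ → ψ` is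
treated as `¬ (φ ∧ ¬ ψ)`, and falsity is forced by no world; thus `p ⊩ ¬ φ` amounts to
`(∀ q ≼ p) ¬ q ⊩ φ`. -/
def force [L.IsRelational] :
    ∀ {n : ℕ}, L.BoundedFormula α n → (kripkeLang L).Formula (Unit ⊕ (α ⊕ Fin n))
  | _, .falsum => ⊥
  | _, .equal t₁ t₂ =>
      allBelow (exBelow (starF PredSym.eq (Sum.inl ()) (fun i => Sum.inr (![varOf t₁, varOf t₂] i))))
  | _, .rel R ts =>
      allBelow (exBelow (starF (PredSym.rel R) (Sum.inl ()) (fun i => Sum.inr (varOf (ts i)))))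
  | _, .imp f g => allBelow (Formula.not (force f ⊓ allBelow (Formula.not (force g))))
  | n, .all f =>
      allBelow (allS (elemP L) (β := Unit)
        ((domF L (Sum.inl (Sum.inl ())) (Sum.inr ())).imp
          ((force f).relabel fun x => match x with
            | .inl _ => .inl (.inl ())
            | .inr (.inl a) => .inl (.inr (.inl a))
            | .inr (.inr i) =>
                Fin.lastCases (motive := fun _ => (Unit ⊕ (α ⊕ Fin n)) ⊕ Unit)
                  (.inr ()) (fun i' => .inl (.inr (.inr i'))) i)))

/-- The sentence `∀ p (p ⊩ φ)`. -/
def forced [L.IsRelational] (φ : L.Sentence) : (kripkeLang L).Sentence :=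
  allS (worldP L) (β := Unit) ((force φ).relabel
    (Sum.elim Sum.inr (fun x => Sum.inl (x.elim id (fun i => isEmptyElim i)))))

end Forcing

/-- The axioms of `KM(T)` that do not depend on the axioms of `T`. -/
inductive KripkeAxiom : (kripkeLang L).Sentence → Prop
  | refl : KripkeAxiom
      (allS (worldP L) (β := Unit) (leF L (Sum.inr ()) (Sum.inr ())))
  | trans : KripkeAxiom
      (allS (worldP L) (β := Fin 3)
        ((leF L (Sum.inr 0) (Sum.inr 1) ⊓ leF L (Sum.inr 1) (Sum.inr 2)).imp
          (leF L (Sum.inr 0) (Sum.inr 2))))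
  | domNonempty : KripkeAxiom
      (allS (worldP L) (β := Unit) (exS (elemP L) (β := Unit)
        (domF L (Sum.inl (Sum.inr ())) (Sum.inr ()))))
  | domMono : KripkeAxiom
      (allS (worldP L) (β := Fin 2) ((leF L (Sum.inr 1) (Sum.inr 0)).imp
        (allS (elemP L) (β := Unit)
          ((domF L (Sum.inl (Sum.inr 0)) (Sum.inr ())).imp
            (domF L (Sum.inl (Sum.inr 1)) (Sum.inr ()))))))
  | starDom {k : ℕ} (R : PredSym L k) : KripkeAxiom
      (allS (worldP L) (β := Unit) (allS (elemP L) (β := Fin k)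
        ((starF R (Sum.inl (Sum.inr ())) (fun i => Sum.inr i)).imp
          (Formula.iInf fun i : Fin k => domF L (Sum.inl (Sum.inr ())) (Sum.inr i)))))
  | starMono {k : ℕ} (R : PredSym L k) : KripkeAxiom
      (allS (worldP L) (β := Fin 2) ((leF L (Sum.inr 1) (Sum.inr 0)).imp
        (allS (elemP L) (β := Fin k)
          ((starF R (Sum.inl (Sum.inr 0)) (fun i => Sum.inr i)).imp
            (starF R (Sum.inl (Sum.inr 1)) (fun i => Sum.inr i))))))

variable {L}

/-- The theory `KM(T)` of Kripke models of `T`. The identity of `T` is one of its predicates,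
so the identity axioms are among the axioms of `T` that have to be forced. -/
def KM [L.IsRelational] (T : L.Theory) : (kripkeLang L).Theory :=
  {ψ | SortAxiom (kripkeSig L) ψ} ∪ {ψ | KripkeAxiom L ψ} ∪
  forced '' ({ψ | EqAxiom L ψ} ∪ T)

end Kripke

/-- `T` forcing-interprets `U`: there is an interpretation of `KM(U)` in `T`, of some
positive dimension. -/
def ForcingInterprets {L : FirstOrder.Language.{u, v}} {L' : FirstOrder.Language.{u', v'}} [L'.IsRelational]
    (T : L.Theory) (U : L'.Theory) : Prop :=
  ∃ m : ℕ, 0 < m ∧ InterpretsDim m T (KM U)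

end ForcingAS

end

/-!
The interpretation is a class forcing that adds a generic membership relation to a model of `T`.
Its conditions are approximations of the membership relation on a small class of objects, and
everything depends on a definable notion of smallness which contains the empty class, is closed
under adjunction of objects, and does not admit a class of all objects.

*Shrinking.* By the hypothesis, every model `M` of `T` has, uniformly definably, a model of `T`
whose domain is a proper part of `M`: take the first sort of the interpretation of
`T ⊔ ∀ x (x = x)` in `M`, which cannot meet the nonempty second sort (`exists_shrink`). The
interpretation is one-dimensional, so the elements left out are elements of `M`.

*Smallness.* A class `X` is small (`Small`) if it satisfies certain instances of separation and no
model of `T` with domain in `X` is coded by classes. As `T` is finitely axiomatized in a finite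
signature, being a model of `T` is expressed by a single formula; it suffices that the arities of
the available classes exceed those of the predicate symbols.
- The empty class is small, as models are nonempty (`small_of_empty`).
- Adjoining an object `y` to a small class `X` gives a small class (`Small.adjoin`): a model on a
  part of `X ∪ {y}` shrinks to one that omits some `z` of its domain, and moving `y` to the vacant
  place `z` gives a model on a part of `X`. The separation required of `X` turns this model into
  one coded by classes. Separation itself passes from `X` to `X ∪ {y}` once it is stated so as to
  allow some components to be fixed and a given class to be extended (`Sep.adjoin`).
- Outside of a small class there is always another object, since the objects themselves form a
  model of `T` (`Small.exists_notMem`).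

*Forcing.* A condition is a pair `(X, G)` of a small class `X` and a binary class `G` on `X`, read
as the membership relation restricted to `X`; an extension enlarges `X` and adds no elements to
the members of `X` (`condFrame`). The objects are the individuals of every world, and identity and
the predicates of `T` are the actual ones, so that formulas of the language of `T` are forced if
and only if they are true (`decided_relHom`). The axioms of adjunctive set theory are forced
because a fresh object outside of `X` can be made an empty set, or the set `x ∪ {y}` for given `x`
and `y` in `X` (`forces_emptySet`, `forces_adjunctionSet`). The conditions and the objects,
represented by pairs, thus form a model of `KM(AS(T))` that is defined without parameters and
uniformly in all models of `AC_{≤ n}(T)` (`exists_translation`).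
-/

universe w'

noncomputable section

namespace ForcingAS

open FirstOrder FirstOrder.Language

/-! ### Abstract semantics of relational formulas -/

/-- An interpretation of the primitive logical symbols and of the predicate symbols of `L`, with
individuals in `X` and truth values in `H`. Satisfaction in a relativized structure with
definable identity and forcing in a Kripke frame are both of this form. -/
structure Sem (L : FirstOrder.Language.{u, v}) (X : Type w) (H : Type w') where
  bot : H
  imp : H → H → H
  all : (X → H) → H
  eq : X → X → H
  rel : ∀ {k : ℕ}, L.Relations k → (Fin k → X) → H

section Sem

variable {L : FirstOrder.Language.{u, v}} {L' : FirstOrder.Language.{u', v'}}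
  [L.IsRelational] [L'.IsRelational] {X : Type*} {H : Type*} {α β : Type*}

/-- The truth value of a formula under an assignment. -/
def Sem.eval (I : Sem L X H) :
    ∀ {n : ℕ}, L.BoundedFormula α n → (α → X) → (Fin n → X) → H
  | _, .falsum, _, _ => I.bot
  | _, .equal t₁ t₂, v, xs => I.eq (Sum.elim v xs (varOf t₁)) (Sum.elim v xs (varOf t₂))
  | _, .rel R ts, v, xs => I.rel R (fun i => Sum.elim v xs (varOf (ts i)))
  | _, .imp f g, v, xs => I.imp (I.eval f v xs) (I.eval g v xs)
  | _, .all f, v, xs => I.all (fun x => I.eval f v (Fin.snoc xs x))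

theorem varOf_relabel (g : α → β) (t : L.Term α) : varOf (t.relabel g) = g (varOf t) := by
  cases t with
  | var a => rfl
  | func f _ => exact isEmptyElim f

theorem varOf_onTerm (f : L →ᴸ L') (t : L.Term α) : varOf (f.onTerm t) = varOf t := by
  cases t with
  | var a => rfl
  | func f _ => exact isEmptyElim f

theorem realize_eq_varOf {M : Type*} [L.Structure M] (t : L.Term α) (v : α → M) :
    t.realize v = v (varOf t) := by
  cases t with
  | var a => rfl
  | func f _ => exact isEmptyElim f

theorem Sem.eval_relabel (I : Sem L X H) {m n : ℕ} (φ : L.BoundedFormula α n)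
    (g : α → β ⊕ Fin m) (v : β → X) (xs : Fin (m + n) → X) :
    I.eval (φ.relabel g) v xs =
      I.eval φ (Sum.elim v (xs ∘ Fin.castAdd n) ∘ g) (xs ∘ Fin.natAdd m) := by
  have key : ∀ {n : ℕ} (xs : Fin (m + n) → X) (t : L.Term (α ⊕ Fin n)),
      Sum.elim v xs (varOf (t.relabel (BoundedFormula.relabelAux g n))) =
        Sum.elim (Sum.elim v (xs ∘ Fin.castAdd n) ∘ g) (xs ∘ Fin.natAdd m) (varOf t) := by
    intro n xs t
    rw [varOf_relabel, ← BoundedFormula.sumElim_comp_relabelAux]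
    rfl
  induction φ with
  | falsum => rfl
  | equal t₁ t₂ =>
    change I.eq _ _ = I.eq _ _
    rw [key, key]
  | rel R ts =>
    change I.rel R _ = I.rel R _
    congr 1
    funext i
    exact key xs (ts i)
  | imp f g ih₁ ih₂ =>
    change I.imp _ _ = I.imp _ _
    congr 1
    · exact ih₁ xs
    · exact ih₂ xs
  | all f ih =>
    rw [BoundedFormula.relabel_all]
    change I.all _ = I.all _
    congr 1
    funext x
    rw [ih]
    congr 1
    · congr 1
      congr 1
      funext i
      simp only [Function.comp_apply]
      exact Fin.snoc_castSucc (α := fun _ => X) x xs (Fin.castAdd _ i)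
    · funext i
      refine Fin.lastCases ?_ (fun i => ?_) i
      · rw [Fin.snoc_last]
        exact Fin.snoc_last (α := fun _ => X) x xs
      · rw [Fin.snoc_castSucc]
        exact Fin.snoc_castSucc (α := fun _ => X) x xs (Fin.natAdd m i)

/-- Interpretation of the symbols of `L` through a map of predicate symbols. -/
def Sem.comap (I : Sem L' X H) (f : ∀ k, L.Relations k → L'.Relations k) : Sem L X H where
  bot := I.bot
  imp := I.imp
  all := I.all
  eq := I.eq
  rel R := I.rel (f _ R)

theorem Sem.eval_relHom (I : Sem L' X H) (f : ∀ k, L.Relations k → L'.Relations k)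
    {n : ℕ} (φ : L.BoundedFormula α n) (v : α → X) (xs : Fin n → X) :
    I.eval ((relHom f).onBoundedFormula φ) v xs = (I.comap f).eval φ v xs := by
  induction φ with
  | falsum => rfl
  | equal t₁ t₂ =>
    change I.eq _ _ = I.eq _ _
    rw [varOf_onTerm, varOf_onTerm]
  | rel R ts =>
    change I.rel _ _ = I.rel _ _
    congr 1
    funext i
    change Sum.elim v xs (varOf ((relHom f).onTerm (ts i))) = _
    rw [varOf_onTerm]
  | imp f g ih₁ ih₂ =>
    change I.imp _ _ = I.imp _ _
    congr 1
    · exact ih₁ xs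
    · exact ih₂ xs
  | all f ih =>
    change I.all _ = I.all _
    congr 1
    funext x
    exact ih _

end Sem

/-! ### Relativized structures with definable identity -/

/-- A relativized structure: a domain inside `X`, with relations interpreting identity and the
predicate symbols. Only the values at arguments from the domain matter. -/
structure PreStr (L : FirstOrder.Language.{u, v}) (X : Type w) where
  dom : X → Prop
  eq : X → X → Prop
  rel : ∀ {k : ℕ}, L.Relations k → (Fin k → X) → Prop

namespace PreStr

variable {L : FirstOrder.Language.{u, v}} {L' : FirstOrder.Language.{u', v'}}
  [L.IsRelational] [L'.IsRelational] {X Y : Type*} {α β : Type*}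

/-- The two-valued semantics of a relativized structure. -/
def sem (P : PreStr L X) : Sem L X Prop where
  bot := False
  imp p q := p → q
  all p := ∀ x, P.dom x → p x
  eq := P.eq
  rel := P.rel

/-- Satisfaction in a relativized structure. -/
def Sat (P : PreStr L X) {n : ℕ} (φ : L.BoundedFormula α n) (v : α → X) (xs : Fin n → X) : Prop :=
  P.sem.eval φ v xs

section Sat

variable (P : PreStr L X) {n : ℕ} {v : α → X} {xs : Fin n → X}

theorem sat_imp {f g : L.BoundedFormula α n} :
    P.Sat (f.imp g) v xs ↔ (P.Sat f v xs → P.Sat g v xs) := Iff.rfl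

theorem sat_all {f : L.BoundedFormula α (n + 1)} :
    P.Sat f.all v xs ↔ ∀ x, P.dom x → P.Sat f v (Fin.snoc xs x) := Iff.rfl

theorem sat_not {f : L.BoundedFormula α n} : P.Sat f.not v xs ↔ ¬P.Sat f v xs := Iff.rfl

theorem sat_rel₁ {R : L.Relations 1} {a : α ⊕ Fin n} :
    P.Sat (R.boundedFormula₁ (Term.var a)) v xs ↔ P.rel R ![Sum.elim v xs a] := by
  change P.rel R _ ↔ _
  congr!
  rename_i i
  fin_cases i
  rfl

theorem sat_ex {f : L.BoundedFormula α (n + 1)} :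
    P.Sat f.ex v xs ↔ ∃ x, P.dom x ∧ P.Sat f v (Fin.snoc xs x) := by
  rw [BoundedFormula.ex, sat_not, sat_all]
  simp only [sat_not]
  push Not
  rfl

theorem sat_inf {f g : L.BoundedFormula α n} :
    P.Sat (f ⊓ g) v xs ↔ P.Sat f v xs ∧ P.Sat g v xs := by
  change ((P.Sat f v xs → (P.Sat g v xs → False)) → False) ↔ _
  tauto

theorem sat_iInf [Finite β] {f : β → L.BoundedFormula α n} :
    P.Sat (BoundedFormula.iInf f) v xs ↔ ∀ b, P.Sat (f b) v xs := by
  have key : ∀ l : List (L.BoundedFormula α n),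
      P.Sat (l.foldr (· ⊓ ·) ⊤) v xs ↔ ∀ φ ∈ l, P.Sat φ v xs := by
    intro l
    induction l with
    | nil => simpa using (show P.Sat (⊤ : L.BoundedFormula α n) v xs from fun h => h)
    | cons φ l ih => rw [List.foldr_cons, sat_inf, ih]; simp
  simp only [BoundedFormula.iInf, key]
  simp

theorem sat_alls {n : ℕ} {f : L.BoundedFormula α n} {xs : Fin 0 → X} :
    P.Sat f.alls v xs ↔ ∀ ys : Fin n → X, (∀ i, P.dom (ys i)) → P.Sat f v ys := by
  induction n with
  | zero =>
    refine ⟨fun h ys _ => ?_, fun h => h xs (fun i => i.elim0)⟩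
    rwa [Subsingleton.elim ys xs]
  | succ n ih =>
    rw [BoundedFormula.alls, ih]
    refine ⟨fun h ys hy => ?_, fun h ys hy x hx => h _ fun i => ?_⟩
    · have := h (Fin.init ys) (fun i => hy _) (ys (Fin.last n)) (hy _)
      change P.Sat f v _ at this
      rwa [Fin.snoc_init_self] at this
    · refine Fin.lastCases ?_ (fun i => ?_) i
      · simpa using hx
      · simpa using hy i

theorem sat_iAlls [Finite β] {f : L.Formula (α ⊕ β)} {xs : Fin 0 → X} :
    P.Sat (Formula.iAlls β f) v xs ↔
      ∀ y : β → X, (∀ b, P.dom (y b)) → P.Sat f (Sum.elim v y) default := by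
  unfold Formula.iAlls
  generalize Classical.choice _ = e
  rw [sat_alls]
  have key : ∀ ys, P.Sat (BoundedFormula.relabel (fun a => Sum.map id e a) f) v ys ↔
      P.Sat f (Sum.elim v (ys ∘ e)) default := by
    intro ys
    unfold Sat
    rw [Sem.eval_relabel, Subsingleton.elim (ys ∘ Fin.natAdd _) default]
    congr!
    funext a
    cases a <;> rfl
  refine ⟨fun h y hy => ?_, fun h ys hy => ?_⟩
  · have := (key _).1 (h (y ∘ e.symm) fun i => hy _)
    simpa [Function.comp_assoc] using this
  · exact (key _).2 (h _ fun b => hy _)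

end Sat

/-- A structure as a relativized structure with full domain. -/
def ofStructure (L : FirstOrder.Language.{u, v}) (M : Type w) [L.Structure M] : PreStr L M where
  dom _ := True
  eq := (· = ·)
  rel R xs := Structure.RelMap R xs

theorem sat_ofStructure {M : Type*} [L.Structure M] {n : ℕ} (φ : L.BoundedFormula α n)
    (v : α → M) (xs : Fin n → M) : (ofStructure L M).Sat φ v xs ↔ φ.Realize v xs := by
  induction φ with
  | falsum => rfl
  | equal t₁ t₂ =>
    rw [BoundedFormula.Realize, realize_eq_varOf, realize_eq_varOf]
    rfl
  | rel R ts =>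
    simp only [BoundedFormula.Realize, realize_eq_varOf]
    rfl
  | imp f g ih₁ ih₂ => rw [sat_imp, BoundedFormula.realize_imp, ih₁, ih₂]
  | all f ih =>
    rw [sat_all, BoundedFormula.realize_all]
    simp only [ih]
    simp [ofStructure]

/-- The restriction of the domain to the extension of a unary predicate. -/
def restrict (P : PreStr L X) (s : L.Relations 1) : PreStr L X where
  dom x := P.dom x ∧ P.rel s ![x]
  eq := P.eq
  rel := P.rel

theorem sat_relativize (P : PreStr L X) (s : L.Relations 1) {n : ℕ} (φ : L.BoundedFormula α n)
    (v : α → X) (xs : Fin n → X) :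
    P.Sat (relativize s φ) v xs ↔ (P.restrict s).Sat φ v xs := by
  induction φ with
  | falsum => rfl
  | equal t₁ t₂ => rfl
  | rel R ts => rfl
  | imp f g ih₁ ih₂ => rw [relativize, sat_imp, sat_imp, ih₁, ih₂]
  | all f ih =>
    rw [relativize, sat_all, sat_all]
    refine forall_congr' fun x => ?_
    rw [sat_imp, ih]
    rw [sat_rel₁, Sum.elim_inr, Fin.snoc_last]
    exact and_imp.symm

/-- The reduct along a map of predicate symbols. -/
def reduct (P : PreStr L' X) (f : ∀ k, L.Relations k → L'.Relations k) : PreStr L X where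
  dom := P.dom
  eq := P.eq
  rel R := P.rel (f _ R)

theorem sat_relHom (P : PreStr L' X) (f : ∀ k, L.Relations k → L'.Relations k) {n : ℕ}
    (φ : L.BoundedFormula α n) (v : α → X) (xs : Fin n → X) :
    P.Sat ((relHom f).onBoundedFormula φ) v xs ↔ (P.reduct f).Sat φ v xs := by
  unfold Sat
  rw [Sem.eval_relHom]
  rfl

/-- A correspondence between two relativized structures which matches their domains and
preserves identity and all predicates. -/
structure Bisim (P : PreStr L X) (Q : PreStr L Y) (ρ : X → Y → Prop) : Prop where
  dom_left : ∀ {x y}, ρ x y → P.dom x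
  dom_right : ∀ {x y}, ρ x y → Q.dom y
  forth : ∀ x, P.dom x → ∃ y, ρ x y
  back : ∀ y, Q.dom y → ∃ x, ρ x y
  eq : ∀ {x x' y y'}, ρ x y → ρ x' y' → (P.eq x x' ↔ Q.eq y y')
  rel : ∀ {k} (R : L.Relations k) {xs ys}, (∀ i, ρ (xs i) (ys i)) → (P.rel R xs ↔ Q.rel R ys)

theorem Bisim.sat {P : PreStr L X} {Q : PreStr L Y} {ρ : X → Y → Prop} (h : Bisim P Q ρ) {n : ℕ}
    (φ : L.BoundedFormula α n) {v : α → X} {w : α → Y} {xs : Fin n → X} {ys : Fin n → Y}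
    (hv : ∀ a, ρ (v a) (w a)) (hx : ∀ i, ρ (xs i) (ys i)) : P.Sat φ v xs ↔ Q.Sat φ w ys := by
  have key : ∀ {n} {xs : Fin n → X} {ys : Fin n → Y} (_ : ∀ i, ρ (xs i) (ys i)) (a : α ⊕ Fin n),
      ρ (Sum.elim v xs a) (Sum.elim w ys a) := by
    rintro n xs ys hx (a | i)
    · exact hv a
    · exact hx i
  have key' : ∀ {n} {xs : Fin n → X} {ys : Fin n → Y} (_ : ∀ i, ρ (xs i) (ys i)) {x y},
      ρ x y → ∀ i, ρ (Fin.snoc (α := fun _ => X) xs x i) (Fin.snoc (α := fun _ => Y) ys y i) := by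
    intro n xs ys hx x y hxy i
    refine Fin.lastCases ?_ (fun i => ?_) i
    · simpa using hxy
    · simpa using hx i
  induction φ with
  | falsum => rfl
  | equal t₁ t₂ => exact h.eq (key hx _) (key hx _)
  | rel R ts => exact h.rel R fun i => key hx _
  | imp f g ih₁ ih₂ => exact imp_congr (ih₁ hx) (ih₂ hx)
  | all f ih =>
    rw [sat_all, sat_all]
    constructor
    · intro H y hy
      obtain ⟨x, hxy⟩ := h.back y hy
      exact (ih (key' hx hxy)).1 (H x (h.dom_left hxy))
    · intro H x hx'
      obtain ⟨y, hxy⟩ := h.forth x hx'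
      exact (ih (key' hx hxy)).2 (H y (h.dom_right hxy))

/-- A relativized structure is a model of `T` if its domain is nonempty, its identity relation is
a congruence, and it satisfies the axioms of `T`. -/
structure IsModel (T : L.Theory) (P : PreStr L X) : Prop where
  nonempty : ∃ x, P.dom x
  refl : ∀ x, P.dom x → P.eq x x
  symm : ∀ x y, P.dom x → P.dom y → P.eq x y → P.eq y x
  trans : ∀ x y z, P.dom x → P.dom y → P.dom z → P.eq x y → P.eq y z → P.eq x z
  congr : ∀ {k} (R : L.Relations k) (xs ys : Fin k → X), (∀ i, P.dom (xs i)) →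
    (∀ i, P.dom (ys i)) → (∀ i, P.eq (xs i) (ys i)) → P.rel R xs → P.rel R ys
  sat : ∀ ψ ∈ T, P.Sat ψ default default

theorem Bisim.isModel {P : PreStr L X} {Q : PreStr L Y} {ρ : X → Y → Prop} (h : Bisim P Q ρ)
    {T : L.Theory} (hQ : IsModel T Q) : IsModel T P where
  nonempty := by
    obtain ⟨y, hy⟩ := hQ.nonempty
    obtain ⟨x, hx⟩ := h.back y hy
    exact ⟨x, h.dom_left hx⟩
  refl x hx := by
    obtain ⟨y, hy⟩ := h.forth x hx
    exact (h.eq hy hy).2 (hQ.refl y (h.dom_right hy))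
  symm x x' hx hx' e := by
    obtain ⟨y, hy⟩ := h.forth x hx
    obtain ⟨y', hy'⟩ := h.forth x' hx'
    exact (h.eq hy' hy).2 (hQ.symm _ _ (h.dom_right hy) (h.dom_right hy') ((h.eq hy hy').1 e))
  trans x x' x'' hx hx' hx'' e e' := by
    obtain ⟨y, hy⟩ := h.forth x hx
    obtain ⟨y', hy'⟩ := h.forth x' hx'
    obtain ⟨y'', hy''⟩ := h.forth x'' hx''
    exact (h.eq hy hy'').2 (hQ.trans _ _ _ (h.dom_right hy) (h.dom_right hy') (h.dom_right hy'')
      ((h.eq hy hy').1 e) ((h.eq hy' hy'').1 e'))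
  congr R xs xs' hx hx' e hR := by
    choose ys hy using fun i => h.forth _ (hx i)
    choose ys' hy' using fun i => h.forth _ (hx' i)
    exact (h.rel R hy').2 (hQ.congr R ys ys' (fun i => h.dom_right (hy i))
      (fun i => h.dom_right (hy' i)) (fun i => (h.eq (hy i) (hy' i)).1 (e i)) ((h.rel R hy).1 hR))
  sat ψ hψ := (h.sat ψ (fun a => a.elim) (fun i => i.elim0)).2 (hQ.sat ψ hψ)

/-- Identity axioms that hold in a relativized structure make its identity a congruence. -/
theorem isModel_of_sat {T : L.Theory} {P : PreStr L X} (hne : ∃ x, P.dom x)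
    (heq : ∀ ψ, EqAxiom L ψ → P.Sat ψ default default) (hT : ∀ ψ ∈ T, P.Sat ψ default default) :
    IsModel T P where
  nonempty := hne
  refl x hx := heq _ .refl x hx
  symm x y hx hy := heq _ .symm x hx y hy
  trans x y z hx hy hz := heq _ .trans x hx y hy z hz
  congr {k} R xs ys hx hy e hR := by
    have := heq _ (.congr R)
    rw [sat_iAlls] at this
    have := this (fun p => ![xs, ys] p.1 p.2) (by
      rintro ⟨i, j⟩
      fin_cases i
      · exact hx j
      · exact hy j)
    rw [sat_imp, sat_imp] at this
    refine this ?_ hR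
    rw [Formula.iInf, sat_iInf]
    exact e
  sat := hT

end PreStr

/-! ### Translations -/

namespace Translation

variable {L : FirstOrder.Language.{u, v}} {L' : FirstOrder.Language.{u', v'}}
  {m : ℕ} {α : Type*}

/-- The relativized structure that a translation defines in a structure `A`, for the values `a`
of the parameters. -/
def pre (τ : Translation L L' m) {A : Type*} [L.Structure A] (a : Fin τ.params → A) :
    PreStr L' (Fin m → A) where
  dom x := τ.dom.Realize (Sum.elim x a)
  eq x y := τ.eq.Realize (Sum.elim (fun p => ![x, y] p.1 p.2) a)
  rel R xs := (τ.rel R).Realize (Sum.elim (fun p => xs p.1 p.2) a)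

theorem realize_domNonempty (τ : Translation L L' m) {A : Type*} [L.Structure A]
    (a : Fin τ.params → A) : τ.domNonempty.Realize a ↔ ∃ x, (τ.pre a).dom x := by
  rw [domNonempty, Formula.realize_iExs]
  refine exists_congr fun x => ?_
  rw [Formula.realize_relabel]
  change _ ↔ τ.dom.Realize _
  congr!
  funext p
  rcases p with j | p <;> rfl

variable [L'.IsRelational]

theorem realize_tr (τ : Translation L L' m) {A : Type*} [L.Structure A] (a : Fin τ.params → A)
    {n : ℕ} (φ : L'.BoundedFormula α n) (v : α → Fin m → A) (xs : Fin n → Fin m → A) :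
    (τ.tr φ).Realize (Sum.elim (fun p => Sum.elim v xs p.1 p.2) a) ↔ (τ.pre a).Sat φ v xs := by
  induction φ with
  | falsum => rfl
  | equal t₁ t₂ =>
    rw [tr, Formula.realize_relabel]
    change _ ↔ τ.eq.Realize _
    congr!
    funext p
    rcases p with ⟨i, j⟩ | p
    · fin_cases i <;> rfl
    · rfl
  | rel R ts =>
    rw [tr, Formula.realize_relabel]
    change _ ↔ (τ.rel R).Realize _
    congr!
    funext p
    rcases p with ⟨i, j⟩ | p <;> rfl
  | imp f g ih₁ ih₂ => rw [tr, Formula.realize_imp, PreStr.sat_imp, ih₁, ih₂]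
  | all f ih =>
    rw [tr, Formula.realize_iAlls, PreStr.sat_all]
    refine forall_congr' fun x => ?_
    rw [Formula.realize_imp, Formula.realize_relabel, Formula.realize_relabel, ← ih]
    have h₁ : ∀ (z : _ → A), z = Sum.elim x a → (τ.dom.Realize z ↔ (τ.pre a).dom x) := by
      rintro _ rfl; rfl
    refine imp_congr (h₁ _ ?_) ?_
    · funext p
      rcases p with j | p <;> rfl
    · congr!
      funext p
      rcases p with ⟨b | i, j⟩ | p
      · rfl
      · refine Fin.lastCases ?_ (fun i => ?_) i
        · simp
        · simp
      · rfl

theorem realize_trSentence (τ : Translation L L' m) {A : Type*} [L.Structure A]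
    (a : Fin τ.params → A) (ψ : L'.Sentence) :
    (τ.trSentence ψ).Realize a ↔ (τ.pre a).Sat ψ default default := by
  rw [trSentence, Formula.realize_relabel, ← realize_tr]
  congr!
  funext p
  rcases p with ⟨b | i, j⟩ | p
  · exact b.elim
  · exact i.elim0
  · rfl

end Translation

/-! ### Shrinking models -/

namespace PreStr

variable {L : FirstOrder.Language.{u, v}} {L' : FirstOrder.Language.{u', v'}}
  [L.IsRelational] [L'.IsRelational] {X Y : Type*} {α β : Type*}

section Quotient

variable {T : L.Theory} {P : PreStr L X} (hP : IsModel T P)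

/-- Identity in the sense of a relativized model, as a setoid on the domain. -/
def IsModel.setoid : Setoid {x // P.dom x} where
  r x y := P.eq x y
  iseqv :=
    { refl := fun x => hP.refl x x.2
      symm := fun {x y} h => hP.symm x y x.2 y.2 h
      trans := fun {x y z} h h' => hP.trans x y z x.2 y.2 z.2 h h' }

/-- The structure in the ordinary sense obtained from a relativized model by identifying
elements of the domain. -/
def IsModel.Quot : Type _ := Quotient hP.setoid

/-- The class of an element of the domain in the quotient. -/
def IsModel.toQuot (x : X) (hx : P.dom x) : hP.Quot := Quotient.mk hP.setoid ⟨x, hx⟩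

theorem IsModel.exists_rep (q : hP.Quot) : ∃ x hx, hP.toQuot x hx = q := by
  obtain ⟨⟨x, hx⟩, h⟩ := Quotient.exists_rep (s := hP.setoid) q
  exact ⟨x, hx, h⟩

theorem IsModel.toQuot_eq {x y : X} (hx : P.dom x) (hy : P.dom y) :
    hP.toQuot x hx = hP.toQuot y hy ↔ P.eq x y :=
  Quotient.eq (r := hP.setoid)

instance : L.Structure hP.Quot where
  funMap f := isEmptyElim f
  RelMap {k} R qs := ∃ (xs : Fin k → X) (hx : ∀ i, P.dom (xs i)),
    (∀ i, hP.toQuot (xs i) (hx i) = qs i) ∧ P.rel R xs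

instance : Nonempty hP.Quot := let ⟨x, hx⟩ := hP.nonempty; ⟨hP.toQuot x hx⟩

theorem IsModel.bisim_quot :
    Bisim P (ofStructure L hP.Quot) (fun x q => ∃ hx, hP.toQuot x hx = q) where
  dom_left h := h.1
  dom_right _ := trivial
  forth x hx := ⟨_, hx, rfl⟩
  back q _ := hP.exists_rep q
  eq := by
    rintro x y _ _ ⟨hx, rfl⟩ ⟨hy, rfl⟩
    exact (hP.toQuot_eq hx hy).symm
  rel := by
    intro k R xs qs h
    choose hx hq using h
    refine ⟨fun hR => ⟨xs, hx, hq, hR⟩, ?_⟩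
    rintro ⟨ys, hy, hq', hR⟩
    exact hP.congr R ys xs hy hx
      (fun i => (hP.toQuot_eq (hy i) (hx i)).1 ((hq' i).trans (hq i).symm)) hR

theorem IsModel.quot_models : hP.Quot ⊨ T :=
  ⟨fun ψ hψ => (sat_ofStructure ψ _ _).1
    ((hP.bisim_quot.sat ψ (fun a => a.elim) (fun i => i.elim0)).1 (hP.sat ψ hψ))⟩

end Quotient

/-- The relativized structure which a one-dimensional translation defines inside a relativized
structure. -/
def interp (P : PreStr L X) (σ : Translation L L' 1) (a : Fin σ.params → X) : PreStr L' X where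
  dom x := P.dom x ∧ P.Sat σ.dom (Sum.elim (fun _ => x) a) default
  eq x y := P.Sat σ.eq (Sum.elim (fun p => ![x, y] p.1) a) default
  rel R xs := P.Sat (σ.rel R) (Sum.elim (fun p => xs p.1) a) default

end PreStr

variable {L : FirstOrder.Language.{u, v}} [L.IsRelational]

/-- From a translation of `T ⊔ U`, the translation of the language of `T` given by the
first sort. -/
def Translation.fst {m : ℕ} {L' : FirstOrder.Language.{u', v'}}
    (τ : Translation L (flatLang (unionSig L L')) m) : Translation L L m where
  params := τ.params
  par := τ.par
  dom := τ.dom ⊓ (τ.rel (sortP (S := unionSig L L') (0 : Fin 2))).relabel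
    (Sum.map Prod.snd id)
  eq := τ.eq
  rel R := τ.rel (baseP (S := unionSig L L') (Sum.inl R))

/-- If `T` interprets `T` together with a further nonempty sort, then every model of `T` has,
uniformly definably, a model of `T` on a proper part of its domain: the first sort of the
interpreted structure omits the representatives of elements of the second sort. -/
theorem exists_shrink {L' : FirstOrder.Language.{u', v'}} [L'.IsRelational]
    {T : L.Theory} {U : L'.Theory} (hT : InterpretsDim 1 T (disjUnion T U)) :
    ∃ σ : Translation L L 1, ∀ {X : Type w} {P : PreStr L X}, P.IsModel T →
      ∃ a : Fin σ.params → X, (P.interp σ a).IsModel T ∧ ∃ c, P.dom c ∧ ¬(P.interp σ a).dom c := by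
  obtain ⟨τ, hpar, hne, heq, hax⟩ := hT
  refine ⟨τ.fst, fun {X P} hP => ?_⟩
  -- the interpretation is applied in the quotient, which is a structure in the ordinary sense
  have := hP.quot_models
  have h1 := hpar.realize_sentence hP.Quot
  rw [Sentence.Realize, Formula.realize_iExs] at h1
  obtain ⟨b, hb⟩ := h1
  rw [Formula.realize_relabel, Sum.elim_comp_inr] at hb
  have h2 := hne.realize_formula hP.Quot (v := b)
  rw [Formula.realize_imp, Translation.realize_domNonempty] at h2
  have h3 : ∀ ψ, EqAxiom _ ψ → (τ.pre b).Sat ψ default default := fun ψ hψ => by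
    have := (heq ψ hψ).realize_formula hP.Quot (v := b)
    rw [Formula.realize_imp, Translation.realize_trSentence] at this
    exact this hb
  have h4 : ∀ ψ ∈ disjUnion T U, (τ.pre b).Sat ψ default default := fun ψ hψ => by
    have := (hax ψ hψ).realize_formula hP.Quot (v := b)
    rw [Formula.realize_imp, Translation.realize_trSentence] at this
    exact this hb
  -- the interpreted two-sorted structure, and its first sort
  have hN : (τ.pre b).IsModel (disjUnion T U) := PreStr.isModel_of_sat (h2 hb) h3 h4
  let s₀ := sortP (S := unionSig L L') (0 : Fin 2)
  let s₁ := sortP (S := unionSig L L') (1 : Fin 2)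
  let f : ∀ k, L.Relations k → (flatLang (unionSig L L')).Relations k :=
    fun _ R => baseP (S := unionSig L L') (Sum.inl R)
  have hsort : ∀ s : Fin 2, ∃ x, (τ.pre b).dom x ∧
      (τ.pre b).rel (sortP (S := unionSig L L') s) ![x] := by
    intro s
    have := h4 _ (Or.inl (Or.inl (SortAxiom.nonempty (S := unionSig L L') s)))
    rw [PreStr.sat_ex] at this
    obtain ⟨x, hx, h⟩ := this
    exact ⟨x, hx, PreStr.sat_rel₁ _ |>.1 h⟩
  have hdisj : ∀ x, (τ.pre b).dom x → (τ.pre b).rel s₀ ![x] → ¬ (τ.pre b).rel s₁ ![x] := by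
    intro x hx h h'
    have h01 : (0 : Fin 2) ≠ 1 := by decide
    have := h4 _ (Or.inl (Or.inl (SortAxiom.disj (S := unionSig L L') _ _ h01)))
    rw [PreStr.sat_all] at this
    have := this x hx
    rw [PreStr.sat_not, PreStr.sat_inf] at this
    exact this ⟨PreStr.sat_rel₁ _ |>.2 h, PreStr.sat_rel₁ _ |>.2 h'⟩
  have hM : (((τ.pre b).restrict s₀).reduct f).IsModel T :=
    { nonempty := hsort 0
      refl := fun x hx => hN.refl x hx.1
      symm := fun x y hx hy => hN.symm x y hx.1 hy.1
      trans := fun x y z hx hy hz => hN.trans x y z hx.1 hy.1 hz.1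
      congr := fun R xs ys hx hy => hN.congr (f _ R) xs ys (fun i => (hx i).1) fun i => (hy i).1
      sat := fun ψ hψ => by
        have := h4 _ (Or.inl (Or.inr ⟨ψ, hψ, rfl⟩))
        rw [PreStr.sat_relativize] at this
        exact (PreStr.sat_relHom _ f ψ _ _).1 this }
  -- back from the quotient to `P`: the parameters and the interpreted structure are represented
  -- in `P`, whose elements correspond to one-element tuples of the quotient
  choose a ha hab using fun i => hP.exists_rep (b i)
  have key : ∀ {α : Type} (φ : L.Formula (α ⊕ Fin τ.params)) (g : α → X) (g' : α → hP.Quot),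
      (∀ i, ∃ h, hP.toQuot (g i) h = g' i) →
      (P.Sat φ (Sum.elim g a) default ↔ φ.Realize (Sum.elim g' b)) := by
    intro α φ g g' hg
    rw [Formula.Realize, ← PreStr.sat_ofStructure]
    refine hP.bisim_quot.sat φ ?_ (fun i => i.elim0)
    rintro (i | i)
    · exact hg i
    · exact ⟨ha i, hab i⟩
  have hdom : ∀ x hx, P.Sat τ.fst.dom (Sum.elim (fun _ => x) a) default ↔
      (τ.pre b).dom (fun _ => hP.toQuot x hx) ∧ (τ.pre b).rel s₀ ![fun _ => hP.toQuot x hx] := by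
    intro x hx
    refine (key τ.fst.dom _ (fun _ => hP.toQuot x hx) fun _ => ⟨hx, rfl⟩).trans ?_
    change Formula.Realize (_ ⊓ _) _ ↔ _
    rw [Formula.realize_inf, Formula.realize_relabel]
    refine and_congr Iff.rfl ?_
    change _ ↔ (τ.rel s₀).Realize _
    congr!
    funext p
    rcases p with ⟨i, j⟩ | p
    · fin_cases i; rfl
    · rfl
  have hbisim : PreStr.Bisim (P.interp τ.fst a) (((τ.pre b).restrict s₀).reduct f)
      (fun x y => ∃ hx : P.dom x, (fun _ => hP.toQuot x hx) = y ∧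
        (τ.pre b).dom y ∧ (τ.pre b).rel s₀ ![y]) :=
    { dom_left := by
        rintro x _ ⟨hx, rfl, h⟩
        exact ⟨hx, (hdom x hx).2 h⟩
      dom_right := by
        rintro x _ ⟨hx, rfl, h⟩
        exact h
      forth := fun x hx => ⟨_, hx.1, rfl, (hdom x hx.1).1 hx.2⟩
      back := by
        intro y hy
        obtain ⟨x, hx, hxy⟩ := hP.exists_rep (y 0)
        have : (fun _ => hP.toQuot x hx) = y := funext fun i => by fin_cases i; exact hxy
        exact ⟨x, hx, this, hy⟩
      eq := by
        rintro x x' _ _ ⟨hx, rfl, -⟩ ⟨hx', rfl, -⟩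
        refine (key τ.eq _ (fun p => ![hP.toQuot x hx, hP.toQuot x' hx'] p.1) ?_).trans ?_
        · rintro ⟨i, j⟩
          fin_cases i
          · exact ⟨hx, rfl⟩
          · exact ⟨hx', rfl⟩
        · change _ ↔ τ.eq.Realize _
          congr! with ⟨i, j⟩
          fin_cases i <;> rfl
      rel := by
        intro k R xs ys h
        choose hx hxy _ _ using h
        refine key (τ.rel _) _ (fun p => ys p.1 p.2) ?_
        rintro ⟨i, j⟩
        exact ⟨hx i, congrFun (hxy i) j⟩ }
  refine ⟨a, hbisim.isModel hM, ?_⟩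
  obtain ⟨y, hy, hy'⟩ := hsort 1
  obtain ⟨x, hx, hxy⟩ := hP.exists_rep (y 0)
  have : (fun _ => hP.toQuot x hx) = y := funext fun i => by fin_cases i; exact hxy
  refine ⟨x, hx, fun h => ?_⟩
  have := (hdom x hx).1 h.2
  subst y
  exact hdisj _ hy this.2 hy'

/-! ### Uniform definability -/

/-- A family of relations, one on each structure for `ℒ`, is uniformly definable if a single
formula without parameters defines all of them. -/
def UDef (ℒ : FirstOrder.Language.{u', v'}) {α : Type w'}
    (P : ∀ (A : Type w) [ℒ.Structure A], (α → A) → Prop) : Prop :=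
  ∃ φ : ℒ.Formula α, ∀ (A : Type w) [ℒ.Structure A] (v : α → A), φ.Realize v ↔ P A v

namespace UDef

variable {ℒ : FirstOrder.Language.{u', v'}} {α : Type w'} {β ι : Type*}
  {P Q : ∀ (A : Type w) [ℒ.Structure A], (α → A) → Prop}

theorem congr (h : UDef ℒ P) (e : ∀ (A : Type w) [ℒ.Structure A] (v : α → A), P A v ↔ Q A v) :
    UDef ℒ Q := by
  obtain ⟨φ, hφ⟩ := h
  exact ⟨φ, fun A _ v => (hφ A v).trans (e A v)⟩

theorem comp {P : ∀ (A : Type w) [ℒ.Structure A], (β → A) → Prop} (h : UDef ℒ P) (g : β → α) :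
    UDef ℒ (fun A _ (v : α → A) => P A (v ∘ g)) := by
  obtain ⟨φ, hφ⟩ := h
  exact ⟨φ.relabel g, fun A _ v => Formula.realize_relabel.trans (hφ A _)⟩

theorem false : UDef ℒ (α := α) (fun _ _ _ => False) := ⟨⊥, fun _ _ _ => Iff.rfl⟩

theorem imp (hP : UDef ℒ P) (hQ : UDef ℒ Q) : UDef ℒ (fun A _ v => P A v → Q A v) := by
  obtain ⟨φ, hφ⟩ := hP
  obtain ⟨ψ, hψ⟩ := hQ
  exact ⟨φ.imp ψ, fun A _ v => by rw [Formula.realize_imp, hφ, hψ]⟩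

theorem not (hP : UDef ℒ P) : UDef ℒ (fun A _ v => ¬P A v) := hP.imp UDef.false

theorem and (hP : UDef ℒ P) (hQ : UDef ℒ Q) : UDef ℒ (fun A _ v => P A v ∧ Q A v) :=
  (hP.imp hQ.not).not.congr fun _ _ _ => by tauto

theorem or (hP : UDef ℒ P) (hQ : UDef ℒ Q) : UDef ℒ (fun A _ v => P A v ∨ Q A v) :=
  (hP.not.imp hQ).congr fun _ _ _ => by tauto

theorem iff (hP : UDef ℒ P) (hQ : UDef ℒ Q) : UDef ℒ (fun A _ v => P A v ↔ Q A v) :=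
  ((hP.imp hQ).and (hQ.imp hP)).congr fun _ _ _ => by tauto

theorem const (p : Prop) : UDef ℒ (α := α) (fun _ _ _ => p) := by
  by_cases hp : p
  · exact UDef.false.not.congr fun _ _ _ => by simp [hp]
  · exact UDef.false.congr fun _ _ _ => by simp [hp]

theorem eq (a b : α) : UDef ℒ (fun A _ (v : α → A) => v a = v b) :=
  ⟨Term.equal (Term.var a) (Term.var b), fun A _ v => by simp⟩

theorem rel {k : ℕ} (R : ℒ.Relations k) (x : Fin k → α) :
    UDef ℒ (fun A _ (v : α → A) => Structure.RelMap R (fun i => v (x i))) :=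
  ⟨R.formula fun i => Term.var (x i), fun A _ v => by simp [Formula.realize_rel]⟩

theorem forall_finite [Finite ι] {P : ι → ∀ (A : Type w) [ℒ.Structure A], (α → A) → Prop}
    (h : ∀ i, UDef ℒ (P i)) : UDef ℒ (fun A _ v => ∀ i, P i A v) := by
  choose φ hφ using h
  exact ⟨Formula.iInf φ, fun A _ v => by
    rw [Formula.realize_iInf]; exact forall_congr' fun i => hφ i A v⟩

theorem all [Finite β] {P : ∀ (A : Type w) [ℒ.Structure A], (α → A) → (β → A) → Prop}
    (h : UDef ℒ (α := α ⊕ β) fun A _ v => P A (fun a => v (Sum.inl a)) (fun b => v (Sum.inr b))) :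
    UDef ℒ (fun A _ v => ∀ b, P A v b) := by
  obtain ⟨φ, hφ⟩ := h
  exact ⟨Formula.iAlls β φ, fun A _ v => by
    rw [Formula.realize_iAlls]; exact forall_congr' fun b => hφ A _⟩

theorem ex [Finite β] {P : ∀ (A : Type w) [ℒ.Structure A], (α → A) → (β → A) → Prop}
    (h : UDef ℒ (α := α ⊕ β) fun A _ v => P A (fun a => v (Sum.inl a)) (fun b => v (Sum.inr b))) :
    UDef ℒ (fun A _ v => ∃ b, P A v b) := by
  obtain ⟨φ, hφ⟩ := h
  exact ⟨Formula.iExs β φ, fun A _ v => by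
    rw [Formula.realize_iExs]; exact exists_congr fun b => hφ A _⟩

theorem all₁ {P : ∀ (A : Type w) [ℒ.Structure A], (α → A) → A → Prop}
    (h : UDef ℒ (α := α ⊕ Unit) fun A _ v => P A (fun a => v (Sum.inl a)) (v (Sum.inr ()))) :
    UDef ℒ (fun A _ v => ∀ x : A, P A v x) :=
  (UDef.all (β := Unit) (P := fun A _ v b => P A v (b ())) h).congr fun _ _ _ =>
    ⟨fun H x => H fun _ => x, fun H b => H (b ())⟩

theorem ex₁ {P : ∀ (A : Type w) [ℒ.Structure A], (α → A) → A → Prop}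
    (h : UDef ℒ (α := α ⊕ Unit) fun A _ v => P A (fun a => v (Sum.inl a)) (v (Sum.inr ()))) :
    UDef ℒ (fun A _ v => ∃ x : A, P A v x) :=
  (UDef.ex (β := Unit) (P := fun A _ v b => P A v (b ())) h).congr fun _ _ _ =>
    ⟨fun ⟨b, H⟩ => ⟨b (), H⟩, fun ⟨x, H⟩ => ⟨fun _ => x, H⟩⟩

end UDef

/-- Uniform definability of a family of relativized structures with parameters from `γ`. -/
structure UPre (ℒ : FirstOrder.Language.{u', v'}) {L : FirstOrder.Language.{u, v}} {γ : Type w'}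
    (S : ∀ (A : Type w) [ℒ.Structure A], (γ → A) → PreStr L A) : Prop where
  dom : UDef ℒ (α := γ ⊕ Unit) fun A _ v => (S A (fun c => v (Sum.inl c))).dom (v (Sum.inr ()))
  eq : UDef ℒ (α := γ ⊕ Fin 2) fun A _ v =>
    (S A (fun c => v (Sum.inl c))).eq (v (Sum.inr 0)) (v (Sum.inr 1))
  rel : ∀ {k} (R : L.Relations k), UDef ℒ (α := γ ⊕ Fin k) fun A _ v =>
    (S A (fun c => v (Sum.inl c))).rel R (fun i => v (Sum.inr i))

namespace PreStr

variable {L : FirstOrder.Language.{u, v}} {X Y : Type*}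

/-- The relativized structure obtained by pulling back along a relation, which is meant to be
a partial function. -/
def pull (P : PreStr L Y) (ρ : X → Y → Prop) : PreStr L X where
  dom x := ∃ y, ρ x y ∧ P.dom y
  eq x x' := ∃ y, ρ x y ∧ ∃ y', ρ x' y' ∧ P.eq y y'
  rel R xs := ∃ ys, (∀ i, ρ (xs i) (ys i)) ∧ P.rel R ys

theorem bisim_pull (P : PreStr L Y) {ρ : X → Y → Prop}
    (hfun : ∀ {x y y'}, ρ x y → ρ x y' → y = y') (hsurj : ∀ y, P.dom y → ∃ x, ρ x y) :
    Bisim (P.pull ρ) P (fun x y => ρ x y ∧ P.dom y) where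
  dom_left h := ⟨_, h⟩
  dom_right h := h.2
  forth _ h := h
  back y hy := let ⟨x, hx⟩ := hsurj y hy; ⟨x, hx, hy⟩
  eq := by
    intro x x' y y' h h'
    constructor
    · rintro ⟨z, hz, z', hz', e⟩
      rwa [hfun h.1 hz, hfun h'.1 hz']
    · exact fun e => ⟨y, h.1, y', h'.1, e⟩
  rel := by
    intro k R xs ys h
    constructor
    · rintro ⟨zs, hz, e⟩
      rwa [show ys = zs from funext fun i => hfun (h i).1 (hz i)]
    · exact fun e => ⟨ys, fun i => (h i).1, e⟩

end PreStr

namespace UPre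

variable {ℒ : FirstOrder.Language.{u', v'}} {L : FirstOrder.Language.{u, v}} {γ : Type*}
  {S : ∀ (A : Type w) [ℒ.Structure A], (γ → A) → PreStr L A} (h : UPre ℒ S)
  {α : Type w'} {δ : Type*}
include h

theorem dom_comp (g : γ → α) (x : α) :
    UDef ℒ (fun A _ v => (S A (fun c => v (g c))).dom (v x)) :=
  h.dom.comp (Sum.elim g fun _ => x)

theorem eq_comp (g : γ → α) (x y : α) :
    UDef ℒ (fun A _ v => (S A (fun c => v (g c))).eq (v x) (v y)) :=
  h.eq.comp (Sum.elim g ![x, y])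

theorem rel_comp {k : ℕ} (R : L.Relations k) (g : γ → α) (x : Fin k → α) :
    UDef ℒ (fun A _ v => (S A (fun c => v (g c))).rel R (fun i => v (x i))) :=
  (h.rel R).comp (Sum.elim g x)

theorem sat [L.IsRelational] {n : ℕ} (φ : L.BoundedFormula δ n) (g : γ → α) (s : δ → α)
    (t : Fin n → α) :
    UDef ℒ (fun A _ v =>
      (S A (fun c => v (g c))).Sat φ (fun d => v (s d)) (fun i => v (t i))) := by
  have key : ∀ {α : Type w'} {n : ℕ} (s : δ → α) (t : Fin n → α) (A : Type w) (v : α → A)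
      (a : δ ⊕ Fin n), v (Sum.elim s t a) =
        Sum.elim (fun d => v (s d)) (fun i => v (t i)) a := by
    rintro α n s t A v (d | i) <;> rfl
  induction φ generalizing α with
  | falsum => exact UDef.false
  | equal t₁ t₂ =>
    refine (h.eq_comp g (Sum.elim s t (varOf t₁)) (Sum.elim s t (varOf t₂))).congr
      fun A _ v => ?_
    rw [key s t A v, key s t A v]
    rfl
  | rel R ts =>
    refine (h.rel_comp R g (fun i => Sum.elim s t (varOf (ts i)))).congr fun A _ v => ?_
    simp only [key]
    rfl
  | imp f₁ f₂ ih₁ ih₂ => exact (ih₁ g s t).imp (ih₂ g s t)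
  | all f ih =>
    refine UDef.all₁ (P := fun A _ v x => (S A (fun c => v (g c))).dom x →
      (S A (fun c => v (g c))).Sat f (fun d => v (s d)) (Fin.snoc (fun i => v (t i)) x))
      ((h.dom_comp _ _).imp ?_)
    refine (ih (α := α ⊕ Unit) (fun c => Sum.inl (g c)) (fun d => Sum.inl (s d))
      (Fin.snoc (fun i => Sum.inl (t i)) (Sum.inr ()))).congr fun A _ v => ?_
    refine iff_of_eq (congrArg _ ?_)
    exact Fin.comp_snoc v _ _

theorem isModel [L.IsRelational] [Finite (Σ k, L.Relations k)] {T : L.Theory} (hfin : T.Finite)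
    (g : γ → α) : UDef ℒ (fun A _ v => (S A (fun c => v (g c))).IsModel T) := by
  have := hfin.to_subtype
  have hdom : ∀ {α : Type w'} (g : γ → α) (x : α), _ := fun {α} => h.dom_comp (α := α)
  have heq : ∀ {α : Type w'} (g : γ → α) (x y : α), _ := fun {α} => h.eq_comp (α := α)
  have h1 : UDef ℒ (fun A _ v => ∃ x, (S A (fun c => v (g c))).dom x) :=
    UDef.ex₁ (hdom _ _)
  have h2 : UDef ℒ (fun A _ v => ∀ x, (S A (fun c => v (g c))).dom x →
      (S A (fun c => v (g c))).eq x x) :=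
    UDef.all₁ ((hdom _ _).imp (heq _ _ _))
  have h3 : UDef ℒ (fun A _ v => ∀ x y, (S A (fun c => v (g c))).dom x →
      (S A (fun c => v (g c))).dom y → (S A (fun c => v (g c))).eq x y →
      (S A (fun c => v (g c))).eq y x) :=
    UDef.all₁ (UDef.all₁ ((hdom _ (Sum.inl (Sum.inr ()))).imp
      ((hdom _ (Sum.inr ())).imp ((heq _ (Sum.inl (Sum.inr ())) (Sum.inr ())).imp
        (heq _ (Sum.inr ()) (Sum.inl (Sum.inr ())))))))
  have h4 : UDef ℒ (fun A _ v => ∀ x y z, (S A (fun c => v (g c))).dom x →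
      (S A (fun c => v (g c))).dom y → (S A (fun c => v (g c))).dom z →
      (S A (fun c => v (g c))).eq x y → (S A (fun c => v (g c))).eq y z →
      (S A (fun c => v (g c))).eq x z) :=
    UDef.all₁ (UDef.all₁ (UDef.all₁ ((hdom _ (Sum.inl (Sum.inl (Sum.inr ())))).imp
      ((hdom _ (Sum.inl (Sum.inr ()))).imp ((hdom _ (Sum.inr ())).imp
        ((heq _ (Sum.inl (Sum.inl (Sum.inr ()))) (Sum.inl (Sum.inr ()))).imp
          ((heq _ (Sum.inl (Sum.inr ())) (Sum.inr ())).imp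
            (heq _ (Sum.inl (Sum.inl (Sum.inr ()))) (Sum.inr ())))))))))
  have h5 : UDef ℒ (fun A _ v => ∀ R : Σ k, L.Relations k, ∀ xs ys : Fin R.1 → A,
      (∀ i, (S A (fun c => v (g c))).dom (xs i)) →
      (∀ i, (S A (fun c => v (g c))).dom (ys i)) →
      (∀ i, (S A (fun c => v (g c))).eq (xs i) (ys i)) →
      (S A (fun c => v (g c))).rel R.2 xs → (S A (fun c => v (g c))).rel R.2 ys) :=
    UDef.forall_finite fun R => UDef.all (UDef.all
      ((UDef.forall_finite fun i => hdom _ (Sum.inl (Sum.inr i))).imp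
        ((UDef.forall_finite fun i => hdom _ (Sum.inr i)).imp
          ((UDef.forall_finite fun i => heq _ (Sum.inl (Sum.inr i)) (Sum.inr i)).imp
            ((h.rel_comp R.2 _ (fun i => Sum.inl (Sum.inr i))).imp
              (h.rel_comp R.2 _ (fun i => Sum.inr i)))))))
  have h6 : UDef ℒ (fun A _ v => ∀ ψ : T, (S A (fun c => v (g c))).Sat ψ.1
      default default) :=
    UDef.forall_finite fun ψ => (h.sat ψ.1 g (fun e => e.elim) (fun i => i.elim0)).congr
      fun A _ v => by congr!
  refine (h1.and (h2.and (h3.and (h4.and (h5.and h6))))).congr fun A _ v => ?_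
  exact ⟨fun ⟨a, b, c, d, e, f⟩ => ⟨a, b, c, d, fun R => e ⟨_, R⟩, fun ψ hψ => f ⟨ψ, hψ⟩⟩,
    fun H => ⟨H.1, H.2, H.3, H.4, fun R => H.5 R.2, fun ψ => H.6 ψ.1 ψ.2⟩⟩

theorem interp [L.IsRelational] {L' : FirstOrder.Language} (σ : Translation L L' 1) :
    UPre ℒ (γ := γ ⊕ Fin σ.params)
      (fun A _ v => (S A fun c => v (Sum.inl c)).interp σ (fun i => v (Sum.inr i))) where
  dom := (h.dom_comp _ _).and <|
    (h.sat σ.dom (fun c => Sum.inl (Sum.inl c))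
      (Sum.elim (fun _ => Sum.inr ()) (fun i => Sum.inl (Sum.inr i))) (fun i => i.elim0)).congr
        fun A _ v => iff_of_eq (congr (congrArg _ (funext fun p => by rcases p with p | p <;> rfl))
          (Subsingleton.elim _ _))
  eq := (h.sat σ.eq (fun c => Sum.inl (Sum.inl c))
      (Sum.elim (fun p => Sum.inr p.1) (fun i => Sum.inl (Sum.inr i))) (fun i => i.elim0)).congr
        fun A _ v => iff_of_eq (congr (congrArg _ (funext fun p => by
          rcases p with ⟨i, j⟩ | p
          · fin_cases i <;> rfl
          · rfl)) (Subsingleton.elim _ _))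
  rel R := (h.sat (σ.rel R) (fun c => Sum.inl (Sum.inl c))
      (Sum.elim (fun p => Sum.inr p.1) (fun i => Sum.inl (Sum.inr i))) (fun i => i.elim0)).congr
        fun A _ v => iff_of_eq (congr (congrArg _ (funext fun p => by rcases p with p | p <;> rfl))
          (Subsingleton.elim _ _))

theorem pull {ε : Type*} {ρ : ∀ (A : Type w) [ℒ.Structure A], (ε → A) → A → A → Prop}
    (hρ : UDef ℒ (α := ε ⊕ Fin 2) fun A _ v =>
      ρ A (fun e => v (Sum.inl e)) (v (Sum.inr 0))
      (v (Sum.inr 1))) :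
    UPre ℒ (γ := γ ⊕ ε) (fun A _ v =>
      (S A fun c => v (Sum.inl c)).pull (ρ A fun e => v (Sum.inr e))) := by
  have key : ∀ {α : Type _} (g : ε → α) (x y : α),
      UDef ℒ (fun A _ v => ρ A (fun e => v (g e)) (v x) (v y)) :=
    fun g x y => hρ.comp (Sum.elim g ![x, y])
  exact
  { dom := UDef.ex₁ ((key _ (Sum.inl (Sum.inr ())) (Sum.inr ())).and (h.dom_comp _ _))
    eq := UDef.ex₁ ((key _ (Sum.inl (Sum.inr 0)) (Sum.inr ())).and
      (UDef.ex₁ ((key _ (Sum.inl (Sum.inl (Sum.inr 1))) (Sum.inr ())).and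
        (h.eq_comp _ (Sum.inl (Sum.inr ())) (Sum.inr ())))))
    rel := fun R => UDef.ex ((UDef.forall_finite fun i =>
      key _ (Sum.inl (Sum.inr i)) (Sum.inr i)).and
      (h.rel_comp R _ (fun i => Sum.inr i))) }

end UPre

/-! ### Models of adjunctive class theory -/

section Realize

variable {L : FirstOrder.Language.{u, v}} {A : Type*} [L.Structure A] {α β : Type*}

theorem realize_formula₁ {s : L.Relations 1} {a : α} {v : α → A} :
    (s.formula₁ (Term.var a)).Realize v ↔ Structure.RelMap s ![v a] := by
  rw [Formula.realize_rel₁]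
  rfl

theorem realize_allS {β : Type} [Finite β] {s : L.Relations 1} {φ : L.Formula (α ⊕ β)}
    {v : α → A} : (allS s φ).Realize v ↔
      ∀ b : β → A, (∀ j, Structure.RelMap s ![b j]) → φ.Realize (Sum.elim v b) := by
  rw [allS, Formula.realize_iAlls]
  refine forall_congr' fun b => ?_
  rw [Formula.realize_imp, Formula.realize_iInf]
  simp only [realize_formula₁]
  rfl

theorem realize_exS {β : Type} [Finite β] {s : L.Relations 1} {φ : L.Formula (α ⊕ β)}
    {v : α → A} : (exS s φ).Realize v ↔
      ∃ b : β → A, (∀ j, Structure.RelMap s ![b j]) ∧ φ.Realize (Sum.elim v b) := by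
  rw [exS, Formula.realize_iExs]
  refine exists_congr fun b => ?_
  rw [Formula.realize_inf, Formula.realize_iInf]
  simp only [realize_formula₁]
  rfl

end Realize

variable {L : FirstOrder.Language.{u, v}} {n : ℕ}

section ClassModel

variable {A : Type w} [(flatLang (classSig L n)).Structure A]

variable (L n) in
/-- `x` is an object. -/
def Obj (x : A) : Prop := Structure.RelMap (objP L (n := n)) ![x]

variable (L) in
/-- `X` is a class of arity `k + 1`. -/
def Cls {k : ℕ} (hk : k < n) (X : A) : Prop := Structure.RelMap (classP L ⟨k, hk⟩) ![X]

variable (L) in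
/-- The tuple `x` belongs to the class `X` of arity `k + 1`. -/
def Mem {k : ℕ} (hk : k < n) (x : Fin (k + 1) → A) (X : A) : Prop :=
  Structure.RelMap (baseP (S := classSig L n) (ClassRel.mem ⟨k, hk⟩))
    (Fin.snoc (α := fun _ => A) x X)

variable (L n A) in
/-- The relativized structure of objects. -/
def objPre : PreStr L A where
  dom := Obj L n
  eq := (· = ·)
  rel R xs := Structure.RelMap (baseP (S := classSig L n) (ClassRel.base R)) xs

theorem realize_memF {α : Type*} {k : ℕ} (hk : k < n) (x : Fin (k + 1) → α) (X : α) (v : α → A) :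
    (memF L ⟨k, hk⟩ x X).Realize v ↔ Mem L hk (fun j => v (x j)) (v X) := by
  rw [memF, Formula.realize_rel]
  refine iff_of_eq (congrArg _ ?_)
  exact Fin.comp_snoc v x X

variable [L.IsRelational] {T : L.Theory} (hA : A ⊨ AC n T)
include hA

theorem not_obj_of_cls {k : ℕ} (hk : k < n) {x : A} (hx : Obj L n x) : ¬Cls L hk x := by
  intro h
  have hne : (none : Option (Fin n)) ≠ some ⟨k, hk⟩ := by simp
  have := hA.realize_of_mem _ (Or.inl (Or.inl (Or.inl
    (SortAxiom.disj (S := classSig L n) _ _ hne))))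
  rw [Sentence.Realize, Formula.Realize, BoundedFormula.realize_all] at this
  have := this x
  rw [BoundedFormula.realize_not, BoundedFormula.realize_inf, BoundedFormula.realize_rel₁,
    BoundedFormula.realize_rel₁] at this
  exact this ⟨hx, h⟩

theorem isModel_objPre : (objPre L n A).IsModel T := by
  have hne := hA.realize_of_mem _ (Or.inl (Or.inl (Or.inl
    (SortAxiom.nonempty (S := classSig L n) (none : Option (Fin n))))))
  rw [Sentence.Realize, Formula.Realize, BoundedFormula.realize_ex] at hne
  obtain ⟨x, hx⟩ := hne
  rw [BoundedFormula.realize_rel₁] at hx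
  exact
  { nonempty := ⟨x, hx⟩
    refl := fun _ _ => rfl
    symm := fun _ _ _ _ => Eq.symm
    trans := fun _ _ _ _ _ _ => Eq.trans
    congr := fun R xs ys _ _ e => by rw [show xs = ys from funext e]; exact id
    sat := fun ψ hψ => by
      have := hA.realize_of_mem _ (Or.inl (Or.inl (Or.inr ⟨ψ, hψ, rfl⟩)))
      rw [Sentence.Realize, Formula.Realize, ← PreStr.sat_ofStructure,
        PreStr.sat_relativize] at this
      have := (PreStr.sat_relHom _ _ ψ _ _).1 this
      refine (PreStr.Bisim.sat (ρ := fun x y => x = y ∧ Obj L n x) ?_ ψ (fun a => a.elim)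
        (fun i => i.elim0)).2 this
      exact
      { dom_left := fun h => h.2
        dom_right := fun h => ⟨trivial, h.1 ▸ h.2⟩
        forth := fun x hx => ⟨x, rfl, hx⟩
        back := fun x hx => ⟨x, rfl, hx.2⟩
        eq := fun h h' => by rw [h.1, h'.1]; rfl
        rel := fun R xs ys h => by rw [show xs = ys from funext fun i => (h i).1]; rfl } }

theorem exists_empty {k : ℕ} (hk : k < n) :
    ∃ X : A, Cls L hk X ∧ ∀ x, (∀ j, Obj L n (x j)) → ¬Mem L hk x X := by
  have := hA.realize_of_mem _ (Or.inl (Or.inr ⟨⟨k, hk⟩, rfl⟩))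
  rw [Sentence.Realize, emptyClass, realize_exS] at this
  obtain ⟨X, hX, h⟩ := this
  refine ⟨X (), hX (), fun x hx => ?_⟩
  rw [realize_allS] at h
  have := h x hx
  rw [Formula.realize_not, realize_memF] at this
  exact this

theorem exists_adjoin {k : ℕ} (hk : k < n) {X : A} (hX : Cls L hk X) {x : Fin (k + 1) → A}
    (hx : ∀ j, Obj L n (x j)) :
    ∃ Y : A, Cls L hk Y ∧
      ∀ y, (∀ j, Obj L n (y j)) → (Mem L hk y Y ↔ Mem L hk y X ∨ y = x) := by
  have := hA.realize_of_mem _ (Or.inr ⟨⟨k, hk⟩, rfl⟩)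
  rw [Sentence.Realize, adjunctionClass, realize_allS] at this
  have := this (fun _ => X) (fun _ => hX)
  rw [realize_allS] at this
  have := this x hx
  rw [realize_exS] at this
  obtain ⟨Y, hY, h⟩ := this
  refine ⟨Y (), hY (), fun y hy => ?_⟩
  rw [realize_allS] at h
  have := h y hy
  rw [Formula.realize_iff, Formula.realize_sup, realize_memF, realize_memF,
    Formula.realize_iInf] at this
  simp only [Formula.realize_equal] at this
  rw [funext_iff]
  exact this

end ClassModel

/-! ### Codes of relativized structures by classes -/

variable (L) in
/-- The constituents of a relativized structure: its domain, its identity, and the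
interpretations of the predicate symbols. -/
inductive Part : Type v
  | dom : Part
  | eq : Part
  | rel {k : ℕ} (R : L.Relations k) : Part

/-- The predicate of arity `k` is coded by a class of arity `k + 1` with a dummy argument, since
there are no classes of arity `0`. The value of `arity` is one less than the arity of the code. -/
def Part.arity : Part L → ℕ
  | .dom => 0
  | .eq => 1
  | .rel (k := k) _ => k

instance [Finite (Σ k, L.Relations k)] : Finite (Part L) := by
  refine Finite.of_surjective (α := Option (Option (Σ k, L.Relations k)))
    (fun | none => .dom | some none => .eq | some (some R) => .rel R.2) ?_
  rintro (_ | _ | R)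
  · exact ⟨none, rfl⟩
  · exact ⟨some none, rfl⟩
  · exact ⟨some (some ⟨_, R⟩), rfl⟩

/-- The relation by which a constituent of a relativized structure is to be coded. -/
def PreStr.part {X : Type*} (P : PreStr L X) : (κ : Part L) → (Fin (κ.arity + 1) → X) → Prop
  | .dom, x => P.dom (x (0 : Fin 1))
  | .eq, x => P.eq (x (0 : Fin 2)) (x (1 : Fin 2))
  | .rel R, x => P.rel R (fun j => x j.castSucc)

section Codes

variable (hn : ∀ κ : Part L, κ.arity < n) {A : Type w} [(flatLang (classSig L n)).Structure A]

/-- Membership in a unary class. -/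
def In (X x : A) : Prop := Mem L (k := 0) (hn .dom) ![x] X

/-- Membership of a pair in a binary class. -/
def Pr (G x y : A) : Prop := Mem L (k := 1) (hn .eq) ![x, y] G

/-- The relativized structure on objects coded by classes. The dummy argument of the code of a
predicate ranges over the domain, so that a code can be found inside the powers of the domain. -/
def coded (c : Part L → A) : PreStr L A where
  dom x := Obj L n x ∧ In hn (c .dom) x
  eq x y := Pr hn (c .eq) x y
  rel {k} R xs := ∃ d, (Obj L n d ∧ In hn (c .dom) d) ∧
    Mem L (k := k) (hn (.rel R)) (Fin.snoc (α := fun _ => A) xs d) (c (.rel R))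

/-- The `k`-tuples with the components in `S` from the class `X` and the others equal to those
of `a`. -/
def Box (X : A) {k : ℕ} (S : Set (Fin k)) (a x : Fin k → A) : Prop :=
  ∀ j, (j ∈ S ∧ In hn X (x j)) ∨ (j ∉ S ∧ x j = a j)

/-- Strong separation from powers of `X` for the relation `ψ`: the part of any box over `X` cut
out by `ψ` can be adjoined to any class. In this form, which allows some of the components to be
fixed and an arbitrary class to be extended, separation is preserved when an element is adjoined
to `X`. -/
def Sep {k : ℕ} (hk : k < n) (ψ : (Fin (k + 1) → A) → Prop) (X : A) : Prop :=
  ∀ S : Set (Fin (k + 1)), ∀ a : Fin (k + 1) → A, (∀ j, Obj L n (a j)) → ∀ Z, Cls L hk Z →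
    ∃ Y, Cls L hk Y ∧ ∀ x : Fin (k + 1) → A, (∀ j, Obj L n (x j)) →
      (Mem L hk x Y ↔ Mem L hk x Z ∨ (Box hn X S a x ∧ ψ x))

variable {hn}

theorem Sep.adjoin {k : ℕ} {hk : k < n} {ψ : (Fin (k + 1) → A) → Prop} {X X' y : A}
    (h : Sep hn hk ψ X) (hy : Obj L n y)
    (hX' : ∀ x, Obj L n x → (In hn X' x ↔ In hn X x ∨ x = y)) : Sep hn hk ψ X' := by
  classical
  intro S a ha Z hZ
  -- a box over `X ∪ {y}` is the union of the boxes over `X` with some components equal to `y`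
  let a' : Fin (k + 1) → A := fun j => if j ∈ S then y else a j
  have ha' : ∀ j, Obj L n (a' j) := by
    intro j
    by_cases hj : j ∈ S
    · simpa [a', hj] using hy
    · simpa [a', hj] using ha j
  have key : ∀ F : Finset (Set (Fin (k + 1))), ∃ Y, Cls L hk Y ∧
      ∀ x : Fin (k + 1) → A, (∀ j, Obj L n (x j)) →
        (Mem L hk x Y ↔ Mem L hk x Z ∨ ∃ S' ∈ F, Box hn X S' a' x ∧ ψ x) := by
    intro F
    induction F using Finset.induction_on with
    | empty => exact ⟨Z, hZ, fun x hx => by simp⟩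
    | insert S' F _ ih =>
      obtain ⟨Y, hY, hYx⟩ := ih
      obtain ⟨Y', hY', hYx'⟩ := h S' a' ha' Y hY
      refine ⟨Y', hY', fun x hx => ?_⟩
      rw [hYx' x hx, hYx x hx]
      simp only [Finset.mem_insert, exists_eq_or_imp]
      exact or_assoc.trans (or_congr_right or_comm)
  obtain ⟨Y, hY, hYx⟩ := key (Set.toFinite {S' | S' ⊆ S}).toFinset
  refine ⟨Y, hY, fun x hx => (hYx x hx).trans (or_congr_right ?_)⟩
  simp only [Set.Finite.mem_toFinset, Set.mem_ofPred_eq]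
  constructor
  · rintro ⟨S', hS', hB, hψ⟩
    refine ⟨fun j => ?_, hψ⟩
    rcases hB j with hj | hj
    · exact Or.inl ⟨hS' hj.1, (hX' _ (hx j)).2 (Or.inl hj.2)⟩
    · by_cases hjS : j ∈ S
      · exact Or.inl ⟨hjS, (hX' _ (hx j)).2 (Or.inr (by simpa [a', hjS] using hj.2))⟩
      · exact Or.inr ⟨hjS, by simpa [a', hjS] using hj.2⟩
  · rintro ⟨hB, hψ⟩
    refine ⟨{j | j ∈ S ∧ In hn X (x j)}, fun j hj => hj.1, fun j => ?_, hψ⟩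
    by_cases hj : j ∈ S ∧ In hn X (x j)
    · exact Or.inl ⟨hj, hj.2⟩
    · refine Or.inr ⟨hj, ?_⟩
      rcases hB j with hj' | hj'
      · simpa [a', hj'.1] using
          ((hX' _ (hx j)).1 hj'.2).resolve_left fun h => hj ⟨hj'.1, h⟩
      · simpa [a', hj'.1] using hj'.2

variable [L.IsRelational] {T : L.Theory} (hA : A ⊨ AC n T)
include hA

theorem sep_empty {k : ℕ} (hk : k < n) (ψ : (Fin (k + 1) → A) → Prop) {X : A}
    (hX : ∀ x, Obj L n x → ¬In hn X x) : Sep hn hk ψ X := by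
  intro S a ha Z hZ
  by_cases h : S = ∅ ∧ ψ a
  · obtain ⟨Y, hY, hYx⟩ := exists_adjoin hA hk hZ ha
    refine ⟨Y, hY, fun x hx => (hYx x hx).trans (or_congr_right ?_)⟩
    constructor
    · rintro rfl
      exact ⟨fun j => Or.inr ⟨by simp [h.1], rfl⟩, h.2⟩
    · rintro ⟨hB, -⟩
      funext j
      rcases hB j with hj | hj
      · exact (hX _ (hx j) hj.2).elim
      · exact hj.2
  · refine ⟨Z, hZ, fun x hx => ⟨Or.inl, ?_⟩⟩
    rintro (hm | ⟨hB, hψ⟩)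
    · exact hm
    · refine (h ⟨Set.eq_empty_of_forall_notMem fun j hj => ?_, ?_⟩).elim
      · rcases hB j with hj' | hj'
        · exact hX _ (hx j) hj'.2
        · exact hj'.1 hj
      · rwa [show a = x from funext fun j => ?_]
        rcases hB j with hj | hj
        · exact (hX _ (hx j) hj.2).elim
        · exact hj.2.symm

/-- A model of `T` on a part of `X` can be coded by classes if its constituents can be
separated from powers of `X`. -/
theorem exists_coded {P : PreStr L A} {X : A} (hP : P.IsModel T)
    (hdom : ∀ x, P.dom x → Obj L n x ∧ In hn X x) (hsep : ∀ κ, Sep hn (hn κ) (P.part κ) X) :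
    ∃ c, (coded hn c).IsModel T ∧ ∀ x, (coded hn c).dom x → In hn X x := by
  have key : ∀ κ, ∃ Y : A, ∀ x : Fin (κ.arity + 1) → A, (∀ j, Obj L n (x j)) →
      (Mem L (hn κ) x Y ↔ (∀ j, In hn X (x j)) ∧ P.part κ x) := by
    intro κ
    obtain ⟨Z, hZ, hZx⟩ := exists_empty hA (hn κ)
    obtain ⟨o, ho⟩ := hP.nonempty
    obtain ⟨Y, _, hYx⟩ := hsep κ Set.univ (fun _ => o) (fun _ => (hdom o ho).1) Z hZ
    refine ⟨Y, fun x hx => ?_⟩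
    rw [hYx x hx]
    simp [hZx x hx, Box]
  choose c hc using key
  have hone : ∀ {p : A → Prop} (x : A), p x → ∀ j : Fin 1, p (![x] j) := fun x hx j => by
    fin_cases j
    exact hx
  have hcd : ∀ x, (coded hn c).dom x ↔ P.dom x := by
    intro x
    constructor
    · rintro ⟨hx, h⟩
      exact ((hc .dom ![x] (hone x hx)).1 h).2
    · intro hx
      refine ⟨(hdom x hx).1, (hc .dom ![x] (hone x (hdom x hx).1)).2
        ⟨hone x (hdom x hx).2, hx⟩⟩
  refine ⟨c, PreStr.Bisim.isModel (ρ := fun x y => x = y ∧ P.dom x) ?_ hP,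
    fun x hx => (hdom x ((hcd x).1 hx)).2⟩
  exact
  { dom_left := fun h => (hcd _).2 h.2
    dom_right := fun h => h.1 ▸ h.2
    forth := fun x hx => ⟨x, rfl, (hcd x).1 hx⟩
    back := fun x hx => ⟨x, rfl, hx⟩
    eq := by
      rintro x x' _ _ ⟨rfl, hx⟩ ⟨rfl, hx'⟩
      have hall : ∀ j : Fin 2, P.dom (![x, x'] j) := fun j => by
        fin_cases j
        · exact hx
        · exact hx'
      exact (hc .eq ![x, x'] fun j => (hdom _ (hall j)).1).trans
        (and_iff_right fun j => (hdom _ (hall j)).2)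
    rel := by
      intro k R xs ys h
      obtain rfl : xs = ys := funext fun i => (h i).1
      have hall : ∀ d, P.dom d → ∀ j : Fin (k + 1),
          P.dom (Fin.snoc (α := fun _ => A) xs d j) := fun d hd j => by
        refine Fin.lastCases ?_ (fun i => ?_) j
        · simpa using hd
        · simpa using (h i).2
      have hR : ∀ d, P.dom d → (Mem L (k := k) (hn (.rel R))
          (Fin.snoc (α := fun _ => A) xs d) (c (.rel R)) ↔ P.rel R xs) := by
        intro d hd
        refine (hc (.rel R) (Fin.snoc (α := fun _ => A) xs d)
          fun j => (hdom _ (hall d hd j)).1).trans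
          ((and_iff_right fun j => (hdom _ (hall d hd j)).2).trans ?_)
        change P.rel R (fun j => Fin.snoc (α := fun _ => A) xs d j.castSucc) ↔ _
        simp only [Fin.snoc_castSucc]
      constructor
      · rintro ⟨d, hd, hm⟩
        exact (hR d ((hcd d).1 hd)).1 hm
      · intro hm
        obtain ⟨d, hd⟩ := hP.nonempty
        exact ⟨d, (hcd d).2 hd, (hR d hd).2 hm⟩ }

end Codes

/-! ### Small classes -/

section Small

/-- The graph of the partial map sending `z` to `y` and fixing everything else except `y`, where
it is undefined. It frees the place `y` at the expense of the place `z`. -/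
def Shift {A : Type*} (y z x x' : A) : Prop := x ≠ y ∧ ((x = z ∧ x' = y) ∨ (x ≠ z ∧ x' = x))

variable {L : FirstOrder.Language.{u, v}} {n : ℕ} [L.IsRelational] (T : L.Theory)
  (hn : ∀ κ : Part L, κ.arity < n) (σ : Translation L L 1)
  {A : Type w} [(flatLang (classSig L n)).Structure A]

/-- A class is small if it satisfies the required instances of separation and no part of it
carries a model of `T` coded by classes. Separation for the sections of binary classes serves to
copy the elements of a set, for the constituents of the structure of objects to show that not all
objects belong to a small class, and for those of the shifted structures to prove closure under
adjunction. -/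
structure Small (X : A) : Prop where
  cls : Cls L (k := 0) (hn .dom) X
  sep_section : ∀ G y, Sep hn (hn .eq) (fun x : Fin 2 → A => Pr hn G (x 0) y) X
  sep_obj : ∀ κ, Sep hn (hn κ) ((objPre L n A).part κ) X
  sep_shift : ∀ κ c (a : Fin σ.params → A) y z,
    Sep hn (hn κ) ((((coded hn c).interp σ a).pull (Shift y z)).part κ) X
  not_isModel : ∀ c, (∀ x, (coded hn c).dom x → In hn X x) → ¬(coded hn c).IsModel T

variable {T hn σ} (hA : A ⊨ AC n T)
include hA

theorem small_of_empty {X : A} (hX : Cls L (k := 0) (hn .dom) X)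
    (hX' : ∀ x, Obj L n x → ¬In hn X x) : Small T hn σ X where
  cls := hX
  sep_section _ _ := sep_empty hA _ _ hX'
  sep_obj _ := sep_empty hA _ _ hX'
  sep_shift _ _ _ _ _ := sep_empty hA _ _ hX'
  not_isModel c hc hP := by
    obtain ⟨x, hx⟩ := hP.nonempty
    exact hX' x hx.1 (hc x hx)

/-- Smallness is preserved under adjunction: from a model of `T` on a part of `X ∪ {y}` one
obtains another one that misses some `z`, and then, putting `z` in the place of `y`, a model on a
part of `X`. -/
theorem Small.adjoin
    (hσ : ∀ {P : PreStr L A}, P.IsModel T → ∃ a : Fin σ.params → A,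
      (P.interp σ a).IsModel T ∧ ∃ c, P.dom c ∧ ¬(P.interp σ a).dom c)
    {X y : A} (h : Small T hn σ X) (hy : Obj L n y) :
    ∃ X', Small T hn σ X' ∧ ∀ x, Obj L n x → (In hn X' x ↔ In hn X x ∨ x = y) := by
  obtain ⟨X', hX', hXx⟩ := exists_adjoin hA (k := 0) (hn .dom) h.cls (x := ![y])
    (fun j => by fin_cases j; exact hy)
  have hmem : ∀ x, Obj L n x → (In hn X' x ↔ In hn X x ∨ x = y) := by
    intro x hx
    refine (hXx ![x] fun j => by fin_cases j; exact hx).trans (or_congr_right ?_)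
    exact ⟨fun e => congrFun e 0, fun e => by rw [e]⟩
  refine ⟨X', ⟨hX', fun G z => (h.sep_section G z).adjoin hy hmem,
    fun κ => (h.sep_obj κ).adjoin hy hmem,
    fun κ c a y' z => (h.sep_shift κ c a y' z).adjoin hy hmem,
    fun c hc hP => ?_⟩, hmem⟩
  obtain ⟨a, hQ, z, hz, hz'⟩ := hσ hP
  have hb := ((coded hn c).interp σ a).bisim_pull (ρ := Shift y z)
    (fun {x x₁ x₂} h₁ h₂ => by
      rcases h₁ with ⟨-, ⟨e, rfl⟩ | ⟨e, rfl⟩⟩ <;> rcases h₂ with ⟨-, ⟨e', rfl⟩ | ⟨e', rfl⟩⟩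
      · rfl
      · exact (e' e).elim
      · exact (e e').elim
      · rfl)
    (fun x hx => by
      have hxz : x ≠ z := by rintro rfl; exact hz' hx
      by_cases hxy : x = y
      · exact ⟨z, fun e => hxz (hxy.trans e.symm), Or.inl ⟨rfl, hxy⟩⟩
      · exact ⟨x, hxy, Or.inr ⟨hxz, rfl⟩⟩)
  obtain ⟨c', hc', hdom⟩ := exists_coded hA (hb.isModel hQ) (X := X) (fun x hx => by
    obtain ⟨x', ⟨hxy, hx'⟩, hd⟩ := hx
    have hxd : (coded hn c).dom x := by
      rcases hx' with ⟨rfl, -⟩ | ⟨-, rfl⟩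
      · exact hz
      · exact hd.1
    exact ⟨hxd.1, ((hmem x hxd.1).1 (hc x hxd)).resolve_right hxy⟩) (fun κ => h.sep_shift κ c a y z)
  exact h.not_isModel c' hdom hc'

/-- The objects carry a model of `T`, so they are not all contained in a small class. -/
theorem Small.exists_notMem {X : A} (h : Small T hn σ X) : ∃ x, Obj L n x ∧ ¬In hn X x := by
  by_contra! H
  obtain ⟨c, hc, hdom⟩ := exists_coded hA (isModel_objPre hA) (X := X)
    (fun x hx => ⟨hx, H x hx⟩) h.sep_obj
  exact h.not_isModel c hdom hc

end Small

section Definability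

variable {L : FirstOrder.Language.{u, v}} {n : ℕ} {α : Type w'}

theorem UDef.obj (x : α) :
    UDef (flatLang (classSig L n)) (fun _ _ v => Obj L n (v x)) :=
  (UDef.rel (objP L (n := n)) ![x]).congr fun A _ v => by
    refine iff_of_eq (congrArg _ (funext fun i => ?_))
    fin_cases i
    rfl

theorem UDef.cls {k : ℕ} (hk : k < n) (x : α) :
    UDef (flatLang (classSig L n)) (fun _ _ v => Cls L hk (v x)) :=
  (UDef.rel (classP L ⟨k, hk⟩) ![x]).congr fun A _ v => by
    refine iff_of_eq (congrArg _ (funext fun i => ?_))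
    fin_cases i
    rfl

theorem UDef.mem {k : ℕ} (hk : k < n) (x : Fin (k + 1) → α) (X : α) :
    UDef (flatLang (classSig L n)) (fun _ _ v => Mem L hk (fun j => v (x j)) (v X)) :=
  ⟨memF L ⟨k, hk⟩ x X, fun _ _ v => realize_memF hk x X v⟩

variable (hn : ∀ κ : Part L, κ.arity < n)

theorem UDef.in (X x : α) :
    UDef (flatLang (classSig L n)) (fun _ _ v => In hn (v X) (v x)) :=
  (UDef.mem (k := 0) (hn .dom) ![x] X).congr fun A _ v => by
    refine iff_of_eq (congrFun (congrArg _ (funext fun i => ?_)) _)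
    fin_cases i
    rfl

theorem UDef.pr (G x y : α) :
    UDef (flatLang (classSig L n)) (fun _ _ v => Pr hn (v G) (v x) (v y)) :=
  (UDef.mem (k := 1) (hn .eq) ![x, y] G).congr fun A _ v => by
    refine iff_of_eq (congrFun (congrArg _ (funext fun i => ?_)) _)
    fin_cases i <;> rfl

theorem UDef.sep {γ : Type*} {k : ℕ} (hk : k < n)
    {ψ : ∀ (A : Type w) [(flatLang (classSig L n)).Structure A],
      (γ → A) → (Fin (k + 1) → A) → Prop}
    (h : UDef (flatLang (classSig L n)) (α := γ ⊕ Fin (k + 1))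
      fun A _ v => ψ A (fun c => v (Sum.inl c)) (fun i => v (Sum.inr i)))
    (g : γ → α) (X : α) :
    UDef (flatLang (classSig L n)) (fun A _ v => Sep hn hk (ψ A fun c => v (g c)) (v X)) := by
  have hψ : ∀ {α : Type (max u_1 w')} (g : γ → α) (x : Fin (k + 1) → α),
      UDef (flatLang (classSig L n)) (fun A _ v => ψ A (fun c => v (g c)) (fun i => v (x i))) :=
    fun g x => h.comp (Sum.elim g x)
  unfold Sep
  refine UDef.forall_finite fun S => UDef.all ((UDef.forall_finite fun j => UDef.obj _).imp
    (UDef.all₁ ((UDef.cls hk _).imp (UDef.ex₁ ((UDef.cls hk _).and (UDef.all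
      ((UDef.forall_finite fun j => UDef.obj (Sum.inr j)).imp
        ((UDef.mem hk (fun j => Sum.inr j) (Sum.inl (Sum.inr ()))).iff
          ((UDef.mem hk (fun j => Sum.inr j) (Sum.inl (Sum.inl (Sum.inr ())))).or
            (UDef.and ?_ ?_))))))))))
  · unfold Box
    exact UDef.forall_finite fun j => ((UDef.const _).and (UDef.in hn _ (Sum.inr j))).or
      ((UDef.const _).and (UDef.eq (Sum.inr j) (Sum.inl (Sum.inl (Sum.inl (Sum.inr j))))))
  · exact h.comp (Sum.elim (fun c => Sum.inl (Sum.inl (Sum.inl (Sum.inl (g c)))))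
      (fun j => Sum.inr j))

theorem UPre.objPre :
    UPre (flatLang (classSig L n)) (γ := Empty) (fun A _ _ => objPre L n A) where
  dom := UDef.obj _
  eq := UDef.eq _ _
  rel _ := UDef.rel _ _

theorem UPre.coded :
    UPre (flatLang (classSig L n)) (γ := Part L) (fun _ _ c => coded hn c) where
  dom := (UDef.obj _).and (UDef.in hn (Sum.inl Part.dom) _)
  eq := UDef.pr hn (Sum.inl Part.eq) _ _
  rel {k} R := UDef.ex₁ (((UDef.obj (Sum.inr ())).and
    (UDef.in hn (Sum.inl (Sum.inl Part.dom)) (Sum.inr ()))).and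
      ((UDef.mem (k := k) (hn (.rel R))
        (Fin.snoc (α := fun _ => _) (fun i => Sum.inl (Sum.inr i)) (Sum.inr ()))
        (Sum.inl (Sum.inl (Part.rel R)))).congr fun _ _ v =>
          iff_of_eq (congrFun (congrArg _ (Fin.comp_snoc v _ _)) _)))

theorem UDef.part {ℒ : FirstOrder.Language.{u', v'}} {γ : Type*}
    {S : ∀ (A : Type w) [ℒ.Structure A], (γ → A) → PreStr L A} (h : UPre ℒ S) (κ : Part L) :
    UDef ℒ (α := γ ⊕ Fin (κ.arity + 1)) fun A _ v =>
      (S A (fun c => v (Sum.inl c))).part κ (fun i => v (Sum.inr i)) := by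
  cases κ with
  | dom => exact h.dom_comp _ (Sum.inr (0 : Fin 1))
  | eq => exact h.eq_comp _ (Sum.inr (0 : Fin 2)) (Sum.inr (1 : Fin 2))
  | rel R => exact h.rel_comp R _ (fun j => Sum.inr j.castSucc)

theorem UDef.shift {ℒ : FirstOrder.Language.{u', v'}} (y z x x' : α) :
    UDef ℒ (fun (A : Type w) _ v => Shift (A := A) (v y) (v z) (v x) (v x')) :=
  (UDef.eq _ _).not.and (((UDef.eq _ _).and (UDef.eq _ _)).or
    ((UDef.eq _ _).not.and (UDef.eq _ _)))

variable [L.IsRelational] [Finite (Σ k, L.Relations k)] {T : L.Theory} (hfin : T.Finite)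
  (σ : Translation L L 1)
include hfin

theorem UDef.small (X : α) :
    UDef (flatLang (classSig L n)) (fun (A : Type w) _ v => Small T hn σ (A := A) (v X)) := by
  have h1 : UDef (flatLang (classSig L n)) fun (A : Type w) _ (v : α → A) =>
      ∀ G y, Sep hn (hn .eq) (fun x : Fin 2 → A => Pr hn G (x 0) y) (v X) :=
    UDef.all₁ (UDef.all₁ (UDef.sep hn (hn .eq) (γ := Fin 2)
      (ψ := fun A _ c x => Pr hn (c 0) (x (0 : Fin 2)) (c 1))
      (UDef.pr hn _ (Sum.inr (0 : Fin 2)) _) ![Sum.inl (Sum.inr ()), Sum.inr ()] _))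
  have h2 : UDef (flatLang (classSig L n)) fun (A : Type w) _ (v : α → A) =>
      ∀ κ, Sep hn (hn κ) ((ForcingAS.objPre L n A).part κ) (v X) :=
    UDef.forall_finite fun κ => UDef.sep hn (hn κ)
      (ψ := fun A _ c x => (ForcingAS.objPre L n A).part κ x)
      (UDef.part UPre.objPre κ) Empty.elim _
  have hS := ((UPre.coded (L := L) (n := n) hn).interp σ).pull (ε := Fin 2)
    (ρ := fun A _ e => Shift (e 0) (e 1)) (UDef.shift _ _ _ _)
  have h3 : UDef (flatLang (classSig L n)) fun (A : Type w) _ (v : α → A) =>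
      ∀ κ, ∀ c : Part L → A, ∀ a : Fin σ.params → A, ∀ y z,
        Sep hn (hn κ) ((((coded hn c).interp σ a).pull (Shift y z)).part κ) (v X) :=
    UDef.forall_finite fun κ => UDef.all (UDef.all (UDef.all₁ (UDef.all₁
      (UDef.sep hn (hn κ)
        (ψ := fun A _ e => PreStr.part ((((coded hn fun κ => e (Sum.inl (Sum.inl κ))).interp σ
          fun i => e (Sum.inl (Sum.inr i))).pull (Shift (e (Sum.inr 0)) (e (Sum.inr 1))))) κ)
        (UDef.part hS κ)
        (Sum.elim (Sum.elim (fun c => Sum.inl (Sum.inl (Sum.inl (Sum.inr c))))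
          (fun i => Sum.inl (Sum.inl (Sum.inr i)))) ![Sum.inl (Sum.inr ()), Sum.inr ()]) _))))
  have h4 : UDef (flatLang (classSig L n)) fun (A : Type w) _ (v : α → A) =>
      ∀ c : Part L → A, (∀ x, (coded hn c).dom x → In hn (v X) x) → ¬(coded hn c).IsModel T :=
    UDef.all ((UDef.all₁ (((UPre.coded hn).dom_comp (fun c => Sum.inl (Sum.inr c)) _).imp
      (UDef.in hn _ _))).imp ((UPre.coded hn).isModel hfin (fun c => Sum.inr c)).not)
  refine ((UDef.cls (hn .dom) X).and (h1.and (h2.and (h3.and h4)))).congr fun A _ v => ?_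
  exact ⟨fun ⟨a, b, c, d, e⟩ => ⟨a, b, c, d, e⟩, fun ⟨a, b, c, d, e⟩ => ⟨a, b, c, d, e⟩⟩

end Definability

/-! ### Kripke frames and forcing -/

/-- A Kripke frame for `L`, with worlds in `W` and individuals in `D`; `le q p` means `q ≼ p`. -/
structure Frame (L : FirstOrder.Language.{u, v}) (W D : Type*) where
  le : W → W → Prop
  dom : W → D → Prop
  star : ∀ {k : ℕ}, PredSym L k → W → (Fin k → D) → Prop

namespace Frame

variable {L : FirstOrder.Language.{u, v}} {W D : Type*} (F : Frame L W D)

/-- The semantics with the truth value of a formula being the set of worlds that force it. -/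
def sem : Sem L D (W → Prop) where
  bot _ := False
  imp f g p := ∀ q, F.le q p → ¬(f q ∧ ∀ r, F.le r q → ¬g r)
  all f p := ∀ q, F.le q p → ∀ x, F.dom q x → f x q
  eq x y p := ∀ q, F.le q p → ∃ r, F.le r q ∧ F.star .eq r ![x, y]
  rel R xs p := ∀ q, F.le q p → ∃ r, F.le r q ∧ F.star (.rel R) r xs

/-- The interpretation of the predicates on the two-sorted structure of a frame. -/
def baseMap {k : ℕ} (R : KripkeRel L k) : (Fin k → W ⊕ D) → Prop :=
  KripkeRel.casesOn (motive := fun k _ => (Fin k → W ⊕ D) → Prop) R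
    (fun x => ∃ q p, x = ![Sum.inl q, Sum.inl p] ∧ F.le q p)
    (fun x => ∃ p d, x = ![Sum.inl p, Sum.inr d] ∧ F.dom p d)
    (fun R x => ∃ p xs,
      x = Fin.cons (α := fun _ => W ⊕ D) (Sum.inl p) (fun i => Sum.inr (xs i)) ∧ F.star R p xs)

/-- The interpretation of all predicates, the two sorts included. -/
def flatMap {k : ℕ} (R : FlatRel (kripkeSig L) k) : (Fin k → W ⊕ D) → Prop :=
  FlatRel.casesOn (motive := fun k _ => (Fin k → W ⊕ D) → Prop) R
    (fun s x => ![∃ p, x 0 = Sum.inl p, ∃ d, x 0 = Sum.inr d] s)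
    (fun R => F.baseMap R)

/-- The type `W ⊕ D` as the carrier of the structure of a frame. -/
def Carrier (_ : Frame L W D) : Type _ := W ⊕ D

instance : (kripkeLang L).Structure F.Carrier where
  funMap f := isEmptyElim f
  RelMap R x := F.flatMap R x

/-- A world as an element of the structure of a frame. -/
def wd (p : W) : F.Carrier := Sum.inl p

/-- An individual as an element of the structure of a frame. -/
def el (x : D) : F.Carrier := Sum.inr x

theorem relMap_worldP {x : F.Carrier} :
    Structure.RelMap (worldP L) ![x] ↔ ∃ p, x = F.wd p := Iff.rfl

theorem relMap_elemP {x : F.Carrier} :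
    Structure.RelMap (elemP L) ![x] ↔ ∃ d, x = F.el d := Iff.rfl

theorem relMap_le {q p : W} : Structure.RelMap (baseP (S := kripkeSig L) KripkeRel.le)
    ![F.wd q, F.wd p] ↔ F.le q p := by
  constructor
  · rintro ⟨q', p', h, h'⟩
    obtain rfl : q = q' := Sum.inl_injective (congrFun h 0)
    obtain rfl : p = p' := Sum.inl_injective (congrFun h 1)
    exact h'
  · exact fun h => ⟨q, p, rfl, h⟩

theorem relMap_dom {p : W} {x : D} : Structure.RelMap (baseP (S := kripkeSig L) KripkeRel.dom)
    ![F.wd p, F.el x] ↔ F.dom p x := by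
  constructor
  · rintro ⟨q', p', h, h'⟩
    obtain rfl : p = q' := Sum.inl_injective (congrFun h 0)
    obtain rfl : x = p' := Sum.inr_injective (congrFun h 1)
    exact h'
  · exact fun h => ⟨p, x, rfl, h⟩

theorem relMap_star {k : ℕ} {R : PredSym L k} {p : W} {xs : Fin k → D} :
    Structure.RelMap (baseP (S := kripkeSig L) (KripkeRel.star R))
      (Fin.cons (α := fun _ => F.Carrier) (F.wd p) (fun i => F.el (xs i))) ↔ F.star R p xs := by
  constructor
  · rintro ⟨p', xs', h, h'⟩
    obtain rfl : p = p' := Sum.inl_injective (congrFun h 0)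
    obtain rfl : xs = xs' := funext fun i => Sum.inr_injective (congrFun h i.succ)
    exact h'
  · exact fun h => ⟨p, xs, rfl, h⟩

section Realize

variable {α : Type*} {β : Type} [Finite β] {v : α → F.Carrier}

theorem realize_allS_worldP {φ : (kripkeLang L).Formula (α ⊕ β)} :
    (allS (worldP L) φ).Realize v ↔
      ∀ b : β → W, φ.Realize (Sum.elim v fun j => F.wd (b j)) := by
  rw [realize_allS]
  simp only [relMap_worldP]
  refine ⟨fun h b => h _ fun j => ⟨b j, rfl⟩, fun h b hb => ?_⟩
  choose p hp using hb
  rw [show b = fun j => F.wd (p j) from funext hp]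
  exact h p

theorem realize_allS_elemP {φ : (kripkeLang L).Formula (α ⊕ β)} :
    (allS (elemP L) φ).Realize v ↔
      ∀ b : β → D, φ.Realize (Sum.elim v fun j => F.el (b j)) := by
  rw [realize_allS]
  simp only [relMap_elemP]
  refine ⟨fun h b => h _ fun j => ⟨b j, rfl⟩, fun h b hb => ?_⟩
  choose p hp using hb
  rw [show b = fun j => F.el (p j) from funext hp]
  exact h p

theorem realize_exS_worldP {φ : (kripkeLang L).Formula (α ⊕ β)} :
    (exS (worldP L) φ).Realize v ↔
      ∃ b : β → W, φ.Realize (Sum.elim v fun j => F.wd (b j)) := by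
  rw [realize_exS]
  simp only [relMap_worldP]
  refine ⟨fun ⟨b, hb, h⟩ => ?_, fun ⟨b, h⟩ => ⟨_, fun j => ⟨b j, rfl⟩, h⟩⟩
  choose p hp using hb
  rw [show b = fun j => F.wd (p j) from funext hp] at h
  exact ⟨p, h⟩

theorem realize_exS_elemP {φ : (kripkeLang L).Formula (α ⊕ β)} :
    (exS (elemP L) φ).Realize v ↔
      ∃ b : β → D, φ.Realize (Sum.elim v fun j => F.el (b j)) := by
  rw [realize_exS]
  simp only [relMap_elemP]
  refine ⟨fun ⟨b, hb, h⟩ => ?_, fun ⟨b, h⟩ => ⟨_, fun j => ⟨b j, rfl⟩, h⟩⟩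
  choose p hp using hb
  rw [show b = fun j => F.el (p j) from funext hp] at h
  exact ⟨p, h⟩

theorem realize_leF {a b : α} : (leF L a b).Realize v ↔
    Structure.RelMap (baseP (S := kripkeSig L) KripkeRel.le) ![v a, v b] := by
  rw [leF, Formula.realize_rel₂]
  rfl

theorem realize_domF {a b : α} : (domF L a b).Realize v ↔
    Structure.RelMap (baseP (S := kripkeSig L) KripkeRel.dom) ![v a, v b] := by
  rw [domF, Formula.realize_rel₂]
  rfl

theorem realize_starF {k : ℕ} {R : PredSym L k} {a : α} {b : Fin k → α} :
    (starF R a b).Realize v ↔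
      Structure.RelMap (baseP (S := kripkeSig L) (KripkeRel.star R))
        (Fin.cons (α := fun _ => F.Carrier) (v a) (fun i => v (b i))) := by
  rw [starF, Formula.realize_rel]
  refine iff_of_eq (congrArg _ ?_)
  exact Fin.comp_cons v a b

theorem realize_allBelow {φ : (kripkeLang L).Formula (Unit ⊕ α)} {p : W} :
    (allBelow φ).Realize (Sum.elim (fun _ => F.wd p) v) ↔
      ∀ q, F.le q p → φ.Realize (Sum.elim (fun _ => F.wd q) v) := by
  rw [allBelow, realize_allS_worldP]
  have : ∀ b : Unit → W, ((leF L (Sum.inr ()) (Sum.inl (Sum.inl ()))).imp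
      (φ.relabel (Sum.elim (fun _ => Sum.inr ()) (fun a => Sum.inl (Sum.inr a))))).Realize
        (Sum.elim (Sum.elim (fun _ => F.wd p) v) fun j => F.wd (b j)) ↔
      (F.le (b ()) p → φ.Realize (Sum.elim (fun _ => F.wd (b ())) v)) := by
    intro b
    rw [Formula.realize_imp, realize_leF, Formula.realize_relabel]
    refine imp_congr F.relMap_le (iff_of_eq (congrArg _ ?_))
    funext a
    rcases a with a | a <;> rfl
  simp only [this]
  exact ⟨fun h q => h fun _ => q, fun h b => h (b ())⟩

theorem realize_exBelow {φ : (kripkeLang L).Formula (Unit ⊕ α)} {p : W} :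
    (exBelow φ).Realize (Sum.elim (fun _ => F.wd p) v) ↔
      ∃ q, F.le q p ∧ φ.Realize (Sum.elim (fun _ => F.wd q) v) := by
  rw [exBelow, realize_exS_worldP]
  have : ∀ b : Unit → W, ((leF L (Sum.inr ()) (Sum.inl (Sum.inl ()))) ⊓
      (φ.relabel (Sum.elim (fun _ => Sum.inr ()) (fun a => Sum.inl (Sum.inr a)))) :
        (kripkeLang L).Formula _).Realize
        (Sum.elim (Sum.elim (fun _ => F.wd p) v) fun j => F.wd (b j)) ↔
      (F.le (b ()) p ∧ φ.Realize (Sum.elim (fun _ => F.wd (b ())) v)) := by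
    intro b
    rw [Formula.realize_inf, realize_leF, Formula.realize_relabel]
    refine and_congr F.relMap_le (iff_of_eq (congrArg _ ?_))
    funext a
    rcases a with a | a <;> rfl
  simp only [this]
  exact ⟨fun ⟨b, h⟩ => ⟨b (), h⟩, fun ⟨q, h⟩ => ⟨fun _ => q, h⟩⟩

end Realize

section Force

variable [L.IsRelational] {α : Type*}

theorem realize_force {n : ℕ} (φ : L.BoundedFormula α n) (v : α → D) (xs : Fin n → D) (p : W) :
    (force φ).Realize (Sum.elim (fun _ => F.wd p) (fun a => F.el (Sum.elim v xs a))) ↔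
      F.sem.eval φ v xs p := by
  induction φ generalizing p with
  | falsum => rfl
  | equal t₁ t₂ =>
    rw [force, realize_allBelow]
    refine forall₂_congr fun q _ => ?_
    rw [realize_exBelow]
    refine exists_congr fun r => and_congr Iff.rfl ?_
    rw [realize_starF, ← relMap_star]
    refine iff_of_eq (congrArg _ (congrArg _ (funext fun i => ?_)))
    fin_cases i <;> rfl
  | rel R ts =>
    rw [force, realize_allBelow]
    refine forall₂_congr fun q _ => ?_
    rw [realize_exBelow]
    exact exists_congr fun r => and_congr Iff.rfl ((F.realize_starF).trans F.relMap_star)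
  | imp f g ih₁ ih₂ =>
    rw [force, realize_allBelow]
    refine forall₂_congr fun q _ => ?_
    rw [Formula.realize_not, Formula.realize_inf, ih₁, realize_allBelow]
    refine not_congr (and_congr Iff.rfl (forall₂_congr fun r _ => ?_))
    rw [Formula.realize_not, ih₂]
  | all f ih =>
    rw [force, realize_allBelow]
    refine forall₂_congr fun q _ => ?_
    rw [realize_allS_elemP]
    have key : ∀ x : D, _ := fun x => ih (Fin.snoc xs x) q
    refine (⟨fun h x => h fun _ => x, fun h b => h (b ())⟩ : (∀ b : Unit → D, _) ↔
      ∀ x : D, _).trans (forall_congr' fun x => ?_)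
    rw [Formula.realize_imp, realize_domF, Formula.realize_relabel]
    refine imp_congr F.relMap_dom (Iff.trans (iff_of_eq (congrArg _ ?_)) (key x))
    funext a
    rcases a with a | a | i
    · rfl
    · rfl
    · refine Fin.lastCases ?_ (fun i => ?_) i
      · simp
      · simp

/-- A frame which satisfies the general conditions on Kripke models and forces the axioms of `U`
yields a model of `KM(U)`. -/
theorem models_KM {U : L.Theory} [Nonempty W] [Nonempty D] (hrefl : ∀ p, F.le p p)
    (htrans : ∀ p q r, F.le p q → F.le q r → F.le p r) (hdom : ∀ p, ∃ x, F.dom p x)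
    (hmono : ∀ p q x, F.le q p → F.dom p x → F.dom q x)
    (hstar : ∀ {k} (R : PredSym L k) p xs, F.star R p xs → ∀ i, F.dom p (xs i))
    (hstar_mono : ∀ {k} (R : PredSym L k) p q xs, F.le q p → F.star R p xs → F.star R q xs)
    (heq : ∀ φ, EqAxiom L φ → ∀ p, F.sem.eval φ default default p)
    (hU : ∀ φ ∈ U, ∀ p, F.sem.eval φ default default p) : F.Carrier ⊨ KM U := by
  have hforced : ∀ φ : L.Sentence, (∀ p, F.sem.eval φ default default p) →
      F.Carrier ⊨ forced φ := by
    intro φ h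
    rw [Sentence.Realize, forced, realize_allS_worldP]
    intro b
    rw [Formula.realize_relabel]
    refine Eq.mp (congrArg _ ?_) ((F.realize_force φ _ _ (b ())).2 (h (b ())))
    funext a
    rcases a with a | a | i
    · rfl
    · exact a.elim
    · exact i.elim0
  refine ⟨fun ψ hψ => ?_⟩
  rcases hψ with (hψ | hψ) | ⟨φ, hφ | hφ, rfl⟩
  · cases hψ with
    | cover =>
      rw [Sentence.Realize, Formula.Realize, BoundedFormula.realize_all]
      intro a
      rw [BoundedFormula.realize_iSup]
      rcases a with p | x
      · exact ⟨(0 : Fin 2), BoundedFormula.realize_rel₁.2 (F.relMap_worldP.2 ⟨p, rfl⟩)⟩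
      · exact ⟨(1 : Fin 2), BoundedFormula.realize_rel₁.2 (F.relMap_elemP.2 ⟨x, rfl⟩)⟩
    | disj s t hst =>
      rw [Sentence.Realize, Formula.Realize, BoundedFormula.realize_all]
      intro a
      rw [BoundedFormula.realize_not, BoundedFormula.realize_inf, BoundedFormula.realize_rel₁,
        BoundedFormula.realize_rel₁]
      rintro ⟨h, h'⟩
      change F.flatMap (FlatRel.sort s) ![a] at h
      change F.flatMap (FlatRel.sort t) ![a] at h'
      change Fin 2 at s t
      fin_cases s <;> fin_cases t
      · exact hst rfl
      · obtain ⟨p, hp⟩ := h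
        obtain ⟨x, hx⟩ := h'
        exact Sum.inl_ne_inr (hp.symm.trans hx)
      · obtain ⟨p, hp⟩ := h
        obtain ⟨x, hx⟩ := h'
        exact Sum.inr_ne_inl (hp.symm.trans hx)
      · exact hst rfl
    | nonempty s =>
      rw [Sentence.Realize, Formula.Realize, BoundedFormula.realize_ex]
      simp only [BoundedFormula.realize_rel₁]
      change Fin 2 at s
      fin_cases s
      · exact ⟨F.wd (Classical.arbitrary W), F.relMap_worldP.2 ⟨_, rfl⟩⟩
      · exact ⟨F.el (Classical.arbitrary D), F.relMap_elemP.2 ⟨_, rfl⟩⟩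
    | typed R =>
      rw [Sentence.Realize, Formula.realize_iAlls]
      intro x
      rw [Formula.realize_imp, Formula.realize_iInf]
      simp only [realize_formula₁, Formula.realize_rel]
      intro h i
      change F.flatMap (FlatRel.base R) x at h
      cases R with
      | le =>
        obtain ⟨q, p, rfl, -⟩ := h
        fin_cases i <;> exact ⟨_, rfl⟩
      | dom =>
        obtain ⟨q, p, rfl, -⟩ := h
        fin_cases i <;> exact ⟨_, rfl⟩
      | star R =>
        obtain ⟨p, xs, rfl, -⟩ := h
        refine Fin.cases ?_ (fun i => ?_) i
        · exact ⟨_, rfl⟩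
        · exact ⟨_, rfl⟩
  · cases hψ with
    | refl =>
      rw [Sentence.Realize, realize_allS_worldP]
      exact fun b => F.realize_leF.2 (F.relMap_le.2 (hrefl (b ())))
    | trans =>
      rw [Sentence.Realize, realize_allS_worldP]
      intro b
      simp only [Formula.realize_imp, Formula.realize_inf, realize_leF, Sum.elim_inr, relMap_le]
      exact fun h => htrans _ _ _ h.1 h.2
    | domNonempty =>
      rw [Sentence.Realize, realize_allS_worldP]
      intro b
      rw [realize_exS_elemP]
      obtain ⟨x, hx⟩ := hdom (b ())
      exact ⟨fun _ => x, F.realize_domF.2 (F.relMap_dom.2 hx)⟩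
    | domMono =>
      rw [Sentence.Realize, realize_allS_worldP]
      intro b
      simp only [Formula.realize_imp, realize_allS_elemP, realize_leF, realize_domF, Sum.elim_inr,
        Sum.elim_inl, relMap_le, relMap_dom]
      exact fun h x => hmono _ _ _ h
    | starDom R =>
      rw [Sentence.Realize, realize_allS_worldP]
      intro b
      simp only [Formula.realize_imp, realize_allS_elemP, realize_starF, realize_domF, Sum.elim_inr,
        Sum.elim_inl, relMap_star, relMap_dom, Formula.realize_iInf]
      exact fun x h i => hstar R _ _ h i
    | starMono R =>
      rw [Sentence.Realize, realize_allS_worldP]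
      intro b
      simp only [Formula.realize_imp, realize_allS_elemP, realize_starF, realize_leF, Sum.elim_inr,
        Sum.elim_inl, relMap_star, relMap_le]
      exact fun h x => hstar_mono R _ _ _ h
  · exact hforced φ (heq φ hφ)
  · exact hforced φ (hU φ hφ)

end Force

end Frame

/-! ### Decided formulas -/

namespace Frame

variable {L : FirstOrder.Language.{u, v}} [L.IsRelational] {W D : Type*} (F : Frame L W D)
  {α : Type*} {n : ℕ} {p : W} {v : α → D} {xs : Fin n → D}

/-- All worlds below `p` agree that `φ` is forced if and only if `b` holds. -/
def Decided (p : W) (φ : L.BoundedFormula α n) (v : α → D) (xs : Fin n → D) (b : Prop) : Prop :=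
  ∀ q, F.le q p → (F.sem.eval φ v xs q ↔ b)

variable {F}

theorem Decided.of_iff {φ : L.BoundedFormula α n} {b b' : Prop} (h : F.Decided p φ v xs b)
    (e : b ↔ b') : F.Decided p φ v xs b' := fun q hq => (h q hq).trans e

section Order

variable (hrefl : ∀ p, F.le p p) (htrans : ∀ p q r, F.le p q → F.le q r → F.le p r)
include hrefl htrans

theorem Decided.imp {f g : L.BoundedFormula α n} {a b : Prop} (hf : F.Decided p f v xs a)
    (hg : F.Decided p g v xs b) : F.Decided p (f.imp g) v xs (a → b) := by
  intro q hq
  change (∀ r, F.le r q → ¬(_ ∧ ∀ s, F.le s r → ¬_)) ↔ _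
  constructor
  · intro h ha
    by_contra hb
    exact h q (hrefl q) ⟨(hf q hq).2 ha,
      fun r hr hgr => hb ((hg r (htrans _ _ _ hr hq)).1 hgr)⟩
  · rintro h r hr ⟨hfr, hgr⟩
    have hrp := htrans _ _ _ hr hq
    exact hgr r (hrefl r) ((hg r hrp).2 (h ((hf r hrp).1 hfr)))

theorem Decided.not {f : L.BoundedFormula α n} {a : Prop} (hf : F.Decided p f v xs a) :
    F.Decided p f.not v xs (¬a) :=
  hf.imp hrefl htrans (fun _ _ => Iff.rfl)

theorem Decided.inf {f g : L.BoundedFormula α n} {a b : Prop} (hf : F.Decided p f v xs a)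
    (hg : F.Decided p g v xs b) : F.Decided p (f ⊓ g) v xs (a ∧ b) :=
  ((hf.imp hrefl htrans (hg.not hrefl htrans)).not hrefl htrans).of_iff (by tauto)

theorem Decided.sup {f g : L.BoundedFormula α n} {a b : Prop} (hf : F.Decided p f v xs a)
    (hg : F.Decided p g v xs b) : F.Decided p (f ⊔ g) v xs (a ∨ b) :=
  ((hf.not hrefl htrans).imp hrefl htrans hg).of_iff (by tauto)

theorem Decided.iff {f g : L.BoundedFormula α n} {a b : Prop} (hf : F.Decided p f v xs a)
    (hg : F.Decided p g v xs b) : F.Decided p (f.iff g) v xs (a ↔ b) :=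
  ((hf.imp hrefl htrans hg).inf hrefl htrans (hg.imp hrefl htrans hf)).of_iff (by tauto)

theorem Decided.iInf {β : Type*} [Finite β] {f : β → L.BoundedFormula α n} {a : β → Prop}
    (h : ∀ b, F.Decided p (f b) v xs (a b)) :
    F.Decided p (BoundedFormula.iInf f) v xs (∀ b, a b) := by
  have key : ∀ l : List β, F.Decided p ((l.map f).foldr (· ⊓ ·) ⊤) v xs (∀ b ∈ l, a b) := by
    intro l
    induction l with
    | nil =>
      have hbot : F.Decided p (⊥ : L.BoundedFormula α n) v xs False := fun _ _ => Iff.rfl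
      exact (hbot.not hrefl htrans).of_iff (by simp)
    | cons b l ih => exact ((h b).inf hrefl htrans ih).of_iff (by simp)
  exact (key _).of_iff (by simp)

theorem Decided.all {f : L.BoundedFormula α (n + 1)} {a : D → Prop} (hdom : ∀ p x, F.dom p x)
    (h : ∀ x, F.Decided p f v (Fin.snoc xs x) (a x)) : F.Decided p f.all v xs (∀ x, a x) := by
  intro q hq
  constructor
  · exact fun H x => (h x q hq).1 (H q (hrefl q) x (hdom q x))
  · exact fun H r hr x _ => (h x r (htrans _ _ _ hr hq)).2 (H x)

omit htrans in
theorem decided_equal (heq : ∀ p x, F.star .eq p x ↔ x 0 = x 1) (t₁ t₂ : L.Term (α ⊕ Fin n)) :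
    F.Decided p (.equal t₁ t₂) v xs
      (Sum.elim v xs (varOf t₁) = Sum.elim v xs (varOf t₂)) := by
  intro q _
  change (∀ r, F.le r q → ∃ s, F.le s r ∧ F.star .eq s _) ↔ _
  simp only [heq]
  exact ⟨fun h => let ⟨_, _, e⟩ := h q (hrefl q); e, fun e r _ => ⟨r, hrefl r, e⟩⟩

theorem decided_rel {k : ℕ} {R : L.Relations k} {ts : Fin k → L.Term (α ⊕ Fin n)} {b : Prop}
    (h : ∀ q, F.le q p → (F.star (.rel R) q (fun i => Sum.elim v xs (varOf (ts i))) ↔ b)) :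
    F.Decided p (.rel R ts) v xs b := by
  intro q hq
  change (∀ r, F.le r q → ∃ s, F.le s r ∧ F.star (.rel R) s _) ↔ _
  constructor
  · intro H
    obtain ⟨s, hs, h'⟩ := H q (hrefl q)
    exact (h s (htrans _ _ _ hs hq)).1 h'
  · exact fun hb r hr => ⟨r, hrefl r, (h r (htrans _ _ _ hr hq)).2 hb⟩

omit htrans in
/-- An existential formula is forced if witnesses are found densely below the given world. -/
theorem eval_ex_of {f : L.BoundedFormula α (n + 1)}
    (h : ∀ q, F.le q p → ∃ r, F.le r q ∧ ∃ x, F.dom r x ∧ F.sem.eval f v (Fin.snoc xs x) r) :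
    F.sem.eval f.ex v xs p := by
  intro q hq ⟨H, _⟩
  obtain ⟨r, hr, x, hx, hf⟩ := h q hq
  exact H r hr x hx r (hrefl r) ⟨hf, fun _ _ h => h⟩

omit hrefl htrans in
theorem eval_alls_of {n : ℕ} {f : L.BoundedFormula α n} {xs : Fin 0 → D}
    (h : ∀ p ys, F.sem.eval f v ys p) : F.sem.eval f.alls v xs p := by
  induction n with
  | zero => exact h p xs
  | succ n ih => exact ih fun p ys q _ x _ => h q (Fin.snoc ys x)

omit hrefl htrans in
theorem eval_iAlls_of {β : Type*} [Finite β] {f : L.Formula (α ⊕ β)} {xs : Fin 0 → D}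
    (h : ∀ p (y : β → D), F.sem.eval f (Sum.elim v y) default p) :
    F.sem.eval (Formula.iAlls β f) v xs p := by
  unfold Formula.iAlls
  generalize Classical.choice _ = e
  refine eval_alls_of fun p ys => ?_
  rw [Sem.eval_relabel, Subsingleton.elim (ys ∘ Fin.natAdd _) default]
  refine Eq.mp (congrFun (congrFun (congrArg _ ?_) _) _) (h p (ys ∘ e))
  funext a
  cases a <;> rfl

/-- If identity is interpreted by real identity at all worlds, the identity axioms are forced. -/
theorem eval_eqAxiom (hdom : ∀ p x, F.dom p x) (heq : ∀ p x, F.star .eq p x ↔ x 0 = x 1)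
    {φ : L.Sentence} (hφ : EqAxiom L φ) (p : W) : F.sem.eval φ default default p := by
  have hE : ∀ {α : Type} {n : ℕ} {v : α → D} {xs : Fin n → D} (t₁ t₂ : L.Term (α ⊕ Fin n)),
      F.Decided p (.equal t₁ t₂) v xs _ := decided_equal hrefl heq
  cases hφ with
  | refl =>
    refine (Decided.all hrefl htrans hdom (fun x => hE _ _) p (hrefl p)).2 ?_
    exact fun x => rfl
  | symm =>
    refine (Decided.all hrefl htrans hdom (fun x => Decided.all hrefl htrans hdom (fun y =>
      (hE _ _).imp hrefl htrans (hE _ _))) p (hrefl p)).2 ?_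
    exact fun x y => Eq.symm
  | trans =>
    refine (Decided.all hrefl htrans hdom (fun x => Decided.all hrefl htrans hdom (fun y =>
      Decided.all hrefl htrans hdom (fun z =>
      (hE _ _).imp hrefl htrans ((hE _ _).imp hrefl htrans (hE _ _))))) p (hrefl p)).2 ?_
    exact fun x y z => Eq.trans
  | congr R =>
    refine eval_iAlls_of fun p y q hq ⟨he, h⟩ => ?_
    have hy := (Decided.iInf hrefl htrans (fun i => decided_equal hrefl heq
      (Term.var (Sum.inl (Sum.inr ((0 : Fin 2), i))))
      (Term.var (Sum.inl (Sum.inr ((1 : Fin 2), i))))) q (hrefl q)).1 he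
    refine h q (hrefl q) fun r _ ⟨h0, h1⟩ => h1 r (hrefl r) ?_
    refine Eq.mp (congrArg (fun z => F.sem.rel R z r) (funext fun i => ?_)) h0
    exact hy i

end Order

end Frame

/-! ### Forcing with approximations of a membership relation -/

section Conditions

variable {L : FirstOrder.Language.{u, v}} {n : ℕ} [L.IsRelational] (T : L.Theory)
  (hn : ∀ κ : Part L, κ.arity < n) (σ : Translation L L 1)
  {A : Type w} [(flatLang (classSig L n)).Structure A]

/-- Forcing conditions: a small class `X` of objects whose elements have been decided, and a
binary class `G` on `X`, the membership relation with respect to these objects. -/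
def Cond (X G : A) : Prop :=
  Small T hn σ X ∧ Cls L (k := 1) (hn .eq) G ∧
    ∀ x y, Obj L n x → Obj L n y → Pr hn G x y → In hn X x ∧ In hn X y

/-- The condition `(X', G')` extends `(X, G)`: it decides more objects, and agrees on the elements
of the objects decided before. -/
def Extends (X' G' X G : A) : Prop :=
  (∀ x, Obj L n x → In hn X x → In hn X' x) ∧
    ∀ x y, Obj L n x → Obj L n y → In hn X y → (Pr hn G' x y ↔ Pr hn G x y)

/-- The atomic facts at a condition with second component `G`: membership is given by `G`, all
other predicates are interpreted as in the ground model. -/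
def Atomic {k : ℕ} (S : PredSym (setLang L) k) (G : A) : (Fin k → A) → Prop :=
  PredSym.casesOn (motive := fun k _ => (Fin k → A) → Prop) S
    (fun R => SetRel.casesOn (motive := fun k _ => (Fin k → A) → Prop) R
      (fun R xs => Structure.RelMap (baseP (S := classSig L n) (ClassRel.base R)) xs)
      (fun xs => Pr hn G (xs 0) (xs 1)))
    (fun xs => xs 0 = xs 1)

variable (A) in
/-- The frame of conditions, with the objects as the individuals of every world. -/
def condFrame :
    Frame (setLang L) {p : A × A // Cond T hn σ p.1 p.2} {x : A // Obj L n x} where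
  le q p := Extends hn q.1.1 q.1.2 p.1.1 p.1.2
  dom _ _ := True
  star S p xs := Atomic hn S p.1.2 (fun i => (xs i).1)

variable {T hn σ}

theorem condFrame_refl (p) : (condFrame T hn σ A).le p p :=
  ⟨fun _ _ => id, fun _ _ _ _ _ => Iff.rfl⟩

theorem condFrame_trans (p q r) (h : (condFrame T hn σ A).le p q)
    (h' : (condFrame T hn σ A).le q r) : (condFrame T hn σ A).le p r :=
  ⟨fun x hx hr => h.1 x hx (h'.1 x hx hr),
    fun x y hx hy hr => (h.2 x y hx hy (h'.1 y hy hr)).trans (h'.2 x y hx hy hr)⟩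

theorem condFrame_star_mono {k} (S : PredSym (setLang L) k) (p q) (xs)
    (h : (condFrame T hn σ A).le q p) (hS : (condFrame T hn σ A).star S p xs) :
    (condFrame T hn σ A).star S q xs := by
  cases S with
  | eq => exact hS
  | rel R =>
    change SetRel L k at R
    cases R with
    | base R => exact hS
    | mem => exact (h.2 _ _ (xs 0).2 (xs 1).2 (p.2.2.2 _ _ (xs 0).2 (xs 1).2 hS).2).2 hS

theorem condFrame_eq (p) (x : Fin 2 → {x : A // Obj L n x}) :
    (condFrame T hn σ A).star .eq p x ↔ x 0 = x 1 := Subtype.ext_iff.symm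

theorem decided_mem {α : Type*} {m : ℕ} {v : α → {x : A // Obj L n x}}
    {xs : Fin m → {x : A // Obj L n x}} (p : {p : A × A // Cond T hn σ p.1 p.2})
    (a b : α ⊕ Fin m) (hb : In hn p.1.1 (Sum.elim v xs b).1) :
    (condFrame T hn σ A).Decided p ((memP L).boundedFormula₂ (Term.var a) (Term.var b)) v xs
      (Pr hn p.1.2 (Sum.elim v xs a).1 (Sum.elim v xs b).1) :=
  Frame.decided_rel condFrame_refl condFrame_trans fun _ hq =>
    hq.2 _ _ (Subtype.property _) (Subtype.property _) hb

/-- Formulas of the ground language are decided by their truth value in the ground model. -/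
theorem decided_relHom {α : Type*} {m : ℕ} (φ : L.BoundedFormula α m)
    (v : α → {x : A // Obj L n x}) (xs : Fin m → {x : A // Obj L n x}) (p) :
    (condFrame T hn σ A).Decided p
      ((relHom (L' := setLang L) fun _ R => SetRel.base R).onBoundedFormula φ) v xs
      ((objPre L n A).Sat φ (fun a => (v a).1) (fun i => (xs i).1)) := by
  have key : ∀ {m : ℕ} (xs : Fin m → {x : A // Obj L n x}) (a : α ⊕ Fin m),
      (Sum.elim v xs a).1 = Sum.elim (fun a => (v a).1) (fun i => (xs i).1) a := by
    rintro m xs (a | i) <;> rfl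
  induction φ with
  | falsum => exact fun _ _ => Iff.rfl
  | equal t₁ t₂ =>
    refine (Frame.decided_equal condFrame_refl condFrame_eq _ _).of_iff ?_
    rw [varOf_onTerm, varOf_onTerm, Subtype.ext_iff, key, key]
    rfl
  | rel R ts =>
    refine Frame.decided_rel condFrame_refl condFrame_trans fun q _ => ?_
    refine iff_of_eq (congrArg (Structure.RelMap (baseP (S := classSig L n) (ClassRel.base R)))
      (funext fun i => ?_))
    simp only [Function.comp_apply, varOf_onTerm, key]
  | imp f g ih₁ ih₂ => exact (ih₁ xs).imp condFrame_refl condFrame_trans (ih₂ xs)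
  | all f ih =>
    refine (Frame.Decided.all condFrame_refl condFrame_trans (fun _ _ => trivial)
      (fun x => ih (Fin.snoc xs x))).of_iff ?_
    rw [Subtype.forall]
    refine forall₂_congr fun x hx => iff_of_eq (congrArg _ ?_)
    exact Fin.comp_snoc Subtype.val xs (⟨x, hx⟩ : {x : A // Obj L n x})

variable (hA : A ⊨ AC n T)
include hA

theorem nonempty_cond : Nonempty {p : A × A // Cond T hn σ p.1 p.2} := by
  obtain ⟨X, hX, hX'⟩ := exists_empty hA (k := 0) (hn .dom)
  obtain ⟨G, hG, hG'⟩ := exists_empty hA (k := 1) (hn .eq)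
  refine ⟨⟨(X, G), small_of_empty hA hX fun x hx => hX' _ fun j => ?_, hG,
    fun x y hx hy h => (hG' _ (fun j => ?_) h).elim⟩⟩
  · fin_cases j; exact hx
  · fin_cases j
    · exact hx
    · exact hy

variable (hσ : ∀ {P : PreStr L A}, P.IsModel T → ∃ a : Fin σ.params → A,
      (P.interp σ a).IsModel T ∧ ∃ c, P.dom c ∧ ¬(P.interp σ a).dom c)
include hσ

/-- Every object can be decided, if necessary as an object without elements. -/
theorem exists_extends_adjoin (p : {p : A × A // Cond T hn σ p.1 p.2})
    (x : {x : A // Obj L n x}) :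
    ∃ q, (condFrame T hn σ A).le q p ∧ q.1.2 = p.1.2 ∧ In hn q.1.1 x.1 := by
  obtain ⟨⟨X, G⟩, hX, hG, h⟩ := p
  obtain ⟨X', hX', hm⟩ := hX.adjoin hA hσ x.2
  refine ⟨⟨(X', G), hX', hG, fun y z hy hz hyz => ?_⟩, ⟨?_, ?_⟩, rfl, ?_⟩
  · exact ⟨(hm y hy).2 (Or.inl (h y z hy hz hyz).1), (hm z hz).2 (Or.inl (h y z hy hz hyz).2)⟩
  · exact fun y hy hyX => (hm y hy).2 (Or.inl hyX)
  · exact fun _ _ _ _ _ => Iff.rfl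
  · exact (hm _ x.2).2 (Or.inr rfl)

/-- The result of adjoining `y` to `x` can be realized by a fresh object `z`. -/
theorem exists_extends_insert (p : {p : A × A // Cond T hn σ p.1 p.2})
    (x y : {x : A // Obj L n x}) (hx : In hn p.1.1 x.1) (hy : In hn p.1.1 y.1) :
    ∃ q, (condFrame T hn σ A).le q p ∧ ∃ z : {x : A // Obj L n x}, In hn q.1.1 z.1 ∧
      ∀ w : {x : A // Obj L n x}, (Pr hn q.1.2 w.1 z.1 ↔ Pr hn q.1.2 w.1 x.1 ∨ w = y) := by
  obtain ⟨⟨X, G⟩, hX, hG, h⟩ := p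
  obtain ⟨x, hxo⟩ := x
  obtain ⟨y, hyo⟩ := y
  obtain ⟨z, hz, hzX⟩ := hX.exists_notMem hA
  obtain ⟨X', hX', hm⟩ := hX.adjoin hA hσ hz
  have hpair : ∀ {a b : A}, Obj L n a → Obj L n b → ∀ j : Fin 2, Obj L n (![a, b] j) := by
    intro a b ha hb j
    fin_cases j
    · exact ha
    · exact hb
  -- `G₁` adds the elements of `x` to `z`, and `G₂` adds `y`
  obtain ⟨G₁, hG₁, hm₁⟩ := hX.sep_section G x {0} ![z, z] (hpair hz hz) G hG
  obtain ⟨G₂, hG₂, hm₂⟩ := exists_adjoin hA (k := 1) (hn .eq) hG₁ (x := ![y, z]) (hpair hyo hz)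
  have hP : ∀ u w, Obj L n u → Obj L n w → (Pr hn G₂ u w ↔
      Pr hn G u w ∨ (w = z ∧ (Pr hn G u x ∨ u = y))) := by
    intro u w hu hw
    have hB : Box hn X {(0 : Fin 2)} ![z, z] ![u, w] ↔ In hn X u ∧ w = z := by
      constructor
      · intro H
        exact ⟨(H 0).elim (fun H => H.2) fun H => (H.1 rfl).elim,
          (H 1).elim (fun H => absurd H.1 (by simp)) fun H => H.2⟩
      · rintro ⟨H, rfl⟩ j
        fin_cases j
        · exact Or.inl ⟨rfl, H⟩
        · exact Or.inr ⟨by simp, rfl⟩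
    have hE : (![u, w] : Fin 2 → A) = ![y, z] ↔ u = y ∧ w = z :=
      ⟨fun e => ⟨congrFun e 0, congrFun e 1⟩, by rintro ⟨rfl, rfl⟩; rfl⟩
    have e₂ : Pr hn G₂ u w ↔ Pr hn G₁ u w ∨ (u = y ∧ w = z) :=
      (hm₂ ![u, w] (hpair hu hw)).trans (or_congr Iff.rfl hE)
    have e₁ : Pr hn G₁ u w ↔ Pr hn G u w ∨ ((In hn X u ∧ w = z) ∧ Pr hn G u x) :=
      (hm₁ ![u, w] (hpair hu hw)).trans (or_congr Iff.rfl (and_congr hB Iff.rfl))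
    rw [e₂, e₁]
    constructor
    · rintro ((H | ⟨⟨-, e⟩, H⟩) | ⟨e, e'⟩)
      · exact Or.inl H
      · exact Or.inr ⟨e, Or.inl H⟩
      · exact Or.inr ⟨e', Or.inr e⟩
    · rintro (H | ⟨e, H | e'⟩)
      · exact Or.inl (Or.inl H)
      · exact Or.inl (Or.inr ⟨⟨(h u x hu hxo H).1, e⟩, H⟩)
      · exact Or.inr ⟨e', e⟩
  refine ⟨⟨(X', G₂), hX', hG₂, fun u w hu hw H => ?_⟩, ⟨fun u hu H => (hm u hu).2 (Or.inl H), ?_⟩,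
    ⟨z, hz⟩, (hm z hz).2 (Or.inr rfl), ?_⟩
  · rcases (hP u w hu hw).1 H with H | ⟨rfl, H | rfl⟩
    · exact ⟨(hm u hu).2 (Or.inl (h u w hu hw H).1), (hm w hw).2 (Or.inl (h u w hu hw H).2)⟩
    · exact ⟨(hm u hu).2 (Or.inl (h u x hu hxo H).1), (hm w hw).2 (Or.inr rfl)⟩
    · exact ⟨(hm u hu).2 (Or.inl hy), (hm w hw).2 (Or.inr rfl)⟩
  · intro u w hu hw hwX
    refine (hP u w hu hw).trans ⟨fun H => H.resolve_right ?_, Or.inl⟩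
    rintro ⟨rfl, -⟩
    exact hzX hwX
  · rintro ⟨w, hw⟩
    have hxz : x ≠ z := by rintro rfl; exact hzX hx
    have h1 : ¬Pr hn G w z := fun H => hzX (h w z hw hz H).2
    change Pr hn G₂ w z ↔ Pr hn G₂ w x ∨ _
    rw [hP w z hw hz, hP w x hw hxo, Subtype.mk.injEq]
    simp [h1, hxz]

theorem forces_emptySet (p) :
    (condFrame T hn σ A).sem.eval (emptySet L) default default p := by
  refine Frame.eval_ex_of condFrame_refl fun q _ => ?_
  obtain ⟨z, hz, hzX⟩ := q.2.1.exists_notMem hA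
  obtain ⟨r, hr, hG, hzr⟩ := exists_extends_adjoin hA hσ q ⟨z, hz⟩
  refine ⟨r, hr, ⟨z, hz⟩, trivial, ?_⟩
  refine (Frame.Decided.all condFrame_refl condFrame_trans (fun _ _ => trivial) (fun y =>
    (decided_mem r _ _ ?_).not condFrame_refl condFrame_trans) r (condFrame_refl r)).2 ?_
  · exact hzr
  · intro y H
    change Pr hn r.1.2 y.1 z at H
    rw [hG] at H
    exact hzX (q.2.2.2 _ _ y.2 hz H).2

theorem forces_adjunctionSet (p) :
    (condFrame T hn σ A).sem.eval (adjunctionSet L) default default p := by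
  intro p₁ _ x _ p₂ _ y _
  refine Frame.eval_ex_of condFrame_refl fun q hq => ?_
  obtain ⟨q₁, hq₁, -, hx⟩ := exists_extends_adjoin hA hσ q x
  obtain ⟨q₂, hq₂, -, hy⟩ := exists_extends_adjoin hA hσ q₁ y
  have hx₂ := hq₂.1 _ x.2 hx
  obtain ⟨r, hr, z, hz, hzr⟩ := exists_extends_insert hA hσ q₂ x y hx₂ hy
  refine ⟨r, condFrame_trans _ _ _ hr (condFrame_trans _ _ _ hq₂ hq₁), z, trivial, ?_⟩
  refine (Frame.Decided.all condFrame_refl condFrame_trans (fun _ _ => trivial) (fun w =>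
    (decided_mem r _ _ ?_).iff condFrame_refl condFrame_trans
      ((decided_mem r _ _ ?_).sup condFrame_refl condFrame_trans
        (Frame.decided_equal condFrame_refl condFrame_eq _ _))) r (condFrame_refl r)).2 ?_
  · exact hz
  · exact hr.1 _ x.2 hx₂
  · exact hzr

theorem condFrame_models_KM : (condFrame T hn σ A).Carrier ⊨ KM (AS T) := by
  have := nonempty_cond hA (hn := hn) (σ := σ)
  have hobj := (isModel_objPre hA).nonempty
  have : Nonempty {x : A // Obj L n x} := hobj.elim fun x hx => ⟨⟨x, hx⟩⟩
  refine Frame.models_KM _ condFrame_refl condFrame_trans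
    (fun p => ⟨Classical.arbitrary _, trivial⟩) (fun _ _ _ _ _ => trivial)
    (fun _ _ _ _ _ => trivial) condFrame_star_mono
    (fun φ hφ p => Frame.eval_eqAxiom condFrame_refl condFrame_trans (fun _ _ => trivial)
      condFrame_eq hφ p) ?_
  rintro φ (⟨ψ, hψ, rfl⟩ | rfl | rfl) p
  · refine (decided_relHom ψ default default p p (condFrame_refl p)).2 ?_
    have := (isModel_objPre hA).sat ψ hψ
    refine Eq.mp (congr (congrArg _ ?_) ?_) this
    · exact Subsingleton.elim _ _
    · exact Subsingleton.elim _ _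
  · exact forces_emptySet hA hσ p
  · exact forces_adjunctionSet hA hσ p

end Conditions

/-! ### The interpretation of the Kripke model -/

section Interpretation

variable {L : FirstOrder.Language.{u, v}} {n : ℕ} [L.IsRelational] (T : L.Theory)
  (hn : ∀ κ : Part L, κ.arity < n) (σ : Translation L L 1)

section

variable {A : Type w} [(flatLang (classSig L n)).Structure A]

/-- Worlds are represented by the pairs that form a condition. -/
def IsWorld (x : Fin 2 → A) : Prop := Cond T hn σ (x 0) (x 1)

variable (L n) in
/-- Individuals are represented by constant pairs of objects. -/
def IsIndiv (x : Fin 2 → A) : Prop := Obj L n (x 0) ∧ x 1 = x 0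

/-- The interpretation of the predicates of the Kripke model on representing pairs. -/
def kripkeBase {k : ℕ} (R : KripkeRel (setLang L) k) : (Fin k → Fin 2 → A) → Prop :=
  KripkeRel.casesOn (motive := fun k _ => (Fin k → Fin 2 → A) → Prop) R
    (fun xs => IsWorld T hn σ (xs 0) ∧ IsWorld T hn σ (xs 1) ∧
      Extends hn (xs 0 0) (xs 0 1) (xs 1 0) (xs 1 1))
    (fun xs => IsWorld T hn σ (xs 0) ∧ IsIndiv L n (xs 1))
    (fun S xs => IsWorld T hn σ (xs 0) ∧ (∀ i, IsIndiv L n (xs (Fin.succ i))) ∧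
      Atomic hn S (xs 0 1) (fun i => xs (Fin.succ i) 0))

/-- The interpretation of all predicates on representing pairs, the two sorts included. -/
def kripkeFlat {k : ℕ} (R : FlatRel (kripkeSig (setLang L)) k) : (Fin k → Fin 2 → A) → Prop :=
  FlatRel.casesOn (motive := fun k _ => (Fin k → Fin 2 → A) → Prop) R
    (fun s xs => ![IsWorld T hn σ (xs 0), IsIndiv L n (xs 0)] s)
    (fun R => kripkeBase T hn σ R)

variable (A) in
/-- The Kripke model as a relativized structure on pairs. -/
def kripkePre : PreStr (kripkeLang (setLang L)) (Fin 2 → A) where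
  dom x := IsWorld T hn σ x ∨ IsIndiv L n x
  eq x y := ∀ j, x j = y j
  rel R xs := kripkeFlat T hn σ R xs

variable {T hn σ}

/-- The pair which represents an element of the structure of the frame of conditions. -/
def represent : (condFrame T hn σ A).Carrier → Fin 2 → A :=
  Sum.elim (fun p => ![p.1.1, p.1.2]) (fun x => ![x.1, x.1])

theorem isWorld_iff {x : Fin 2 → A} :
    IsWorld T hn σ x ↔ ∃ p, x = represent ((condFrame T hn σ A).wd p) := by
  constructor
  · intro h
    refine ⟨⟨(x 0, x 1), h⟩, funext fun j => ?_⟩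
    fin_cases j <;> rfl
  · rintro ⟨p, rfl⟩
    exact p.2

theorem isIndiv_iff {x : Fin 2 → A} :
    IsIndiv L n x ↔ ∃ d, x = represent ((condFrame T hn σ A).el d) := by
  constructor
  · intro h
    refine ⟨⟨x 0, h.1⟩, funext fun j => ?_⟩
    fin_cases j
    · rfl
    · exact h.2
  · rintro ⟨p, rfl⟩
    exact ⟨p.2, rfl⟩

variable (hA : A ⊨ AC n T)
include hA

theorem represent_injective :
    Function.Injective (represent : (condFrame T hn σ A).Carrier → Fin 2 → A) := by
  rintro (p | x) (q | y) h
  · exact congrArg Sum.inl (Subtype.ext (Prod.ext (congrFun h 0) (congrFun h 1)))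
  · have h' : p.1.1 = y.1 := congrFun h 0
    exact (not_obj_of_cls hA (k := 0) (hn .dom) y.2 (h' ▸ p.2.1.cls)).elim
  · have h' : x.1 = q.1.1 := congrFun h 0
    exact (not_obj_of_cls hA (k := 0) (hn .dom) x.2 (h' ▸ q.2.1.cls)).elim
  · exact congrArg Sum.inr (Subtype.ext (congrFun h 0))

theorem isWorld_represent {c : (condFrame T hn σ A).Carrier} :
    IsWorld T hn σ (represent c) ↔ ∃ p, c = (condFrame T hn σ A).wd p :=
  isWorld_iff.trans (exists_congr fun _ => (represent_injective hA).eq_iff)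

theorem isIndiv_represent {c : (condFrame T hn σ A).Carrier} :
    IsIndiv L n (represent c) ↔ ∃ d, c = (condFrame T hn σ A).el d :=
  isIndiv_iff.trans (exists_congr fun _ => (represent_injective hA).eq_iff)

theorem bisim_kripkePre :
    PreStr.Bisim (kripkePre T hn σ A)
      (PreStr.ofStructure (kripkeLang (setLang L)) (condFrame T hn σ A).Carrier)
      (fun x c => x = represent c) where
  dom_left := by
    rintro _ (p | x) rfl
    · exact Or.inl (isWorld_iff.2 ⟨p, rfl⟩)
    · exact Or.inr (isIndiv_iff.2 ⟨x, rfl⟩)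
  dom_right _ := trivial
  forth x hx := by
    rcases hx with hx | hx
    · obtain ⟨p, hp⟩ := isWorld_iff.1 hx
      exact ⟨_, hp⟩
    · obtain ⟨p, hp⟩ := isIndiv_iff.1 hx
      exact ⟨_, hp⟩
  back c _ := ⟨_, rfl⟩
  eq := by
    rintro _ _ c c' rfl rfl
    exact funext_iff.symm.trans (represent_injective hA).eq_iff
  rel := by
    intro k R xs cs hxs
    obtain rfl : xs = fun i => represent (cs i) := funext hxs
    change kripkeFlat T hn σ R _ ↔ Frame.flatMap _ R cs
    cases R with
    | sort s =>
      change Fin 2 at s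
      fin_cases s
      · exact isWorld_represent hA
      · exact isIndiv_represent hA
    | base R =>
      cases R with
      | le =>
        constructor
        · rintro ⟨h0, h1, h⟩
          obtain ⟨q, hq⟩ := (isWorld_represent hA).1 h0
          obtain ⟨p, hp⟩ := (isWorld_represent hA).1 h1
          obtain rfl : cs = ![Sum.inl q, Sum.inl p] := by
            funext i
            fin_cases i
            · exact hq
            · exact hp
          exact ⟨q, p, rfl, h⟩
        · rintro ⟨q, p, rfl, h⟩
          exact ⟨q.2, p.2, h⟩
      | dom =>
        constructor
        · rintro ⟨h0, h1⟩
          obtain ⟨q, hq⟩ := (isWorld_represent hA).1 h0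
          obtain ⟨p, hp⟩ := (isIndiv_represent hA).1 h1
          obtain rfl : cs = ![Sum.inl q, Sum.inr p] := by
            funext i
            fin_cases i
            · exact hq
            · exact hp
          exact ⟨q, p, rfl, trivial⟩
        · rintro ⟨q, p, rfl, h⟩
          exact ⟨q.2, p.2, rfl⟩
      | star S =>
        constructor
        · rintro ⟨h0, h1, h⟩
          obtain ⟨q, hq⟩ := (isWorld_represent hA).1 h0
          choose zs hz using fun i => (isIndiv_represent hA).1 (h1 i)
          obtain rfl : cs = Fin.cons (α := fun _ => (condFrame T hn σ A).Carrier)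
              ((condFrame T hn σ A).wd q) (fun i => (condFrame T hn σ A).el (zs i)) := by
            funext i
            refine Fin.cases ?_ (fun i => ?_) i
            · exact hq
            · exact hz i
          exact ⟨q, zs, rfl, h⟩
        · rintro ⟨q, zs, rfl, h⟩
          exact ⟨q.2, fun i => ⟨(zs i).2, rfl⟩, h⟩

end

section Definability

variable {α : Type w'}

omit [L.IsRelational] in
theorem UDef.extends (X' G' X G : α) : UDef (flatLang (classSig L n))
    (fun (A : Type w) _ v => Extends (A := A) hn (v X') (v G') (v X) (v G)) :=
  (UDef.all₁ ((UDef.obj _).imp ((UDef.in hn _ _).imp (UDef.in hn _ _)))).and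
    (UDef.all₁ (UDef.all₁ ((UDef.obj (Sum.inl (Sum.inr ()))).imp ((UDef.obj (Sum.inr ())).imp
      ((UDef.in hn _ _).imp ((UDef.pr hn _ (Sum.inl (Sum.inr ())) (Sum.inr ())).iff
        (UDef.pr hn _ _ _)))))))

omit [L.IsRelational] in
theorem UDef.atomic {k : ℕ} (S : PredSym (setLang L) k) (G : α) (x : Fin k → α) :
    UDef (flatLang (classSig L n))
      (fun (A : Type w) _ v => Atomic (A := A) hn S (v G) (fun i => v (x i))) := by
  cases S with
  | eq => exact UDef.eq _ _
  | rel R =>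
    change SetRel L k at R
    cases R with
    | base R => exact UDef.rel _ _
    | mem => exact UDef.pr hn _ _ _

omit [L.IsRelational] in
theorem UDef.isIndiv (x : Fin 2 → α) : UDef (flatLang (classSig L n))
    (fun (A : Type w) _ v => IsIndiv (A := A) L n (fun j => v (x j))) :=
  (UDef.obj _).and (UDef.eq _ _)

variable [Finite (Σ k, L.Relations k)] {T} (hfin : T.Finite)
include hfin

theorem UDef.cond (X G : α) : UDef (flatLang (classSig L n))
    (fun (A : Type w) _ v => Cond (A := A) T hn σ (v X) (v G)) :=
  (UDef.small hn hfin σ _).and ((UDef.cls (hn .eq) _).and (UDef.all₁ (UDef.all₁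
    ((UDef.obj (Sum.inl (Sum.inr ()))).imp ((UDef.obj (Sum.inr ())).imp
      ((UDef.pr hn _ (Sum.inl (Sum.inr ())) (Sum.inr ())).imp
        ((UDef.in hn _ _).and (UDef.in hn _ _))))))))

theorem UDef.isWorld (x : Fin 2 → α) : UDef (flatLang (classSig L n))
    (fun (A : Type w) _ v => IsWorld (A := A) T hn σ (fun j => v (x j))) :=
  UDef.cond hn σ hfin _ _

theorem UDef.kripkeFlat {k : ℕ} (R : FlatRel (kripkeSig (setLang L)) k) (x : Fin k → Fin 2 → α) :
    UDef (flatLang (classSig L n)) (fun (A : Type w) _ v =>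
      kripkeFlat (A := A) T hn σ R (fun i j => v (x i j))) := by
  cases R with
  | sort s =>
    change Fin 2 at s
    fin_cases s
    · exact UDef.isWorld hn σ hfin (x 0)
    · exact UDef.isIndiv (x (0 : Fin 1))
  | base R =>
    cases R with
    | le =>
      exact (UDef.isWorld hn σ hfin (x 0)).and ((UDef.isWorld hn σ hfin (x 1)).and
        (UDef.extends hn (x 0 0) (x 0 1) (x 1 0) (x 1 1)))
    | dom => exact (UDef.isWorld hn σ hfin (x 0)).and (UDef.isIndiv (x 1))
    | star S =>
      exact (UDef.isWorld hn σ hfin (x 0)).and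
        ((UDef.forall_finite fun i => UDef.isIndiv (x (Fin.succ i))).and
          (UDef.atomic hn S (x 0 1) (fun i => x (Fin.succ i) 0)))

/-- The Kripke model is given by a two-dimensional translation without parameters. -/
theorem exists_translation :
    ∃ τ : Translation (flatLang (classSig L n)) (kripkeLang (setLang L)) 2, τ.par = ⊤ ∧
      ∀ (A : Type w) [(flatLang (classSig L n)).Structure A] (a : Fin τ.params → A),
        τ.pre a = kripkePre T hn σ A := by
  have h1 : UDef (flatLang (classSig L n)) (α := Fin 2 ⊕ Fin 0) (fun (A : Type w) _ v =>
      (kripkePre T hn σ A).dom (fun j => v (Sum.inl j))) :=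
    (UDef.isWorld hn σ hfin _).or (UDef.isIndiv _)
  have h2 : UDef (flatLang (classSig L n)) (α := (Fin 2 × Fin 2) ⊕ Fin 0) (fun (A : Type w) _ v =>
      (kripkePre T hn σ A).eq (fun j => v (Sum.inl (0, j))) (fun j => v (Sum.inl (1, j)))) :=
    UDef.forall_finite fun j => UDef.eq _ _
  have h3 : ∀ (k : ℕ) (R : (kripkeLang (setLang L)).Relations k),
      UDef (flatLang (classSig L n)) (α := (Fin k × Fin 2) ⊕ Fin 0) (fun (A : Type w) _ v =>
        (kripkePre T hn σ A).rel R (fun i j => v (Sum.inl (i, j)))) :=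
    fun k R => UDef.kripkeFlat hn σ hfin R fun i j => Sum.inl (i, j)
  obtain ⟨δ, hδ⟩ := h1
  obtain ⟨ε, hε⟩ := h2
  choose ρ hρ using h3
  refine ⟨⟨0, ⊤, δ, ε, fun {k} R => ρ k R⟩, rfl, fun A _ a => ?_⟩
  have e1 : ∀ x : Fin 2 → A, δ.Realize (Sum.elim x a) ↔ _ := fun x => hδ A (Sum.elim x a)
  have e2 : ∀ x y : Fin 2 → A, ε.Realize (Sum.elim (fun p => ![x, y] p.1 p.2) a) ↔ _ :=
    fun x y => hε A _
  have e3 : ∀ {k} (R : (kripkeLang (setLang L)).Relations k) (xs : Fin k → Fin 2 → A),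
      (ρ k R).Realize (Sum.elim (fun p => xs p.1 p.2) a) ↔ _ := fun R xs => hρ _ R A _
  unfold Translation.pre
  congr! 1
  · funext x
    exact propext (e1 x)
  · funext x y
    exact propext (e2 x y)
  · funext k R xs
    exact propext (e3 R xs)

end Definability

end Interpretation

theorem realize_eqAxiom {L : FirstOrder.Language.{u, v}} {M : Type*} [L.Structure M]
    {φ : L.Sentence} (hφ : EqAxiom L φ) : M ⊨ φ := by
  cases hφ with
  | refl => exact fun x => rfl
  | symm => exact fun x y => Eq.symm
  | trans => exact fun x y z => Eq.trans
  | congr R =>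
    rw [Sentence.Realize, Formula.realize_iAlls]
    intro x
    rw [Formula.realize_imp, Formula.realize_imp, Formula.realize_iInf]
    simp only [Formula.realize_equal, Formula.realize_rel]
    intro h h'
    exact Eq.mp (congrArg _ (funext h)) h'

end ForcingAS

end

theorem mainTheorem4 (L : FirstOrder.Language.{u, v}) [L.IsRelational]
    [Finite (Σ k, L.Relations k)] (T : L.Theory) (hfin : T.Finite)
    (hT : ForcingAS.InterpretsDim 1 T (ForcingAS.disjUnion T ForcingAS.trivialTheory)) :
    ∃ N : ℕ, ∀ n : ℕ, N ≤ n →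
      ForcingAS.ForcingInterprets (ForcingAS.AC n T) (ForcingAS.AS T) := by
  open FirstOrder FirstOrder.Language ForcingAS in
  obtain ⟨σ, hσ⟩ := exists_shrink.{u, v, 0, 0, v} hT
  -- the parts of a `T`-structure are coded by classes of arity `arity + 1`, which has to be at most
  -- `n`
  obtain ⟨N, hN⟩ := (Set.finite_range (Part.arity (L := L))).bddAbove
  refine ⟨N + 1, fun n hNn => ⟨2, Nat.two_pos, ?_⟩⟩
  have hn : ∀ κ : Part L, κ.arity < n := fun κ =>
    (Nat.lt_succ_of_le (hN ⟨κ, rfl⟩)).trans_le hNn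
  obtain ⟨τ, hpar, hτ⟩ := exists_translation.{u, v, v} hn σ hfin
  have key : ∀ {A : Type v} [(flatLang (classSig L n)).Structure A], A ⊨ AC n T →
      ∀ (a : Fin τ.params → A) (ψ : (kripkeLang (setLang L)).Sentence),
      (EqAxiom _ ψ ∨ ψ ∈ KM (AS T)) → (τ.trSentence ψ).Realize a := by
    intro A _ hA a ψ hψ
    rw [Translation.realize_trSentence, hτ]
    refine ((bisim_kripkePre hA).sat ψ (fun e => e.elim) (fun i => i.elim0)).2
      ((PreStr.sat_ofStructure ψ default default).2 ?_)
    rcases hψ with hψ | hψ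
    · exact realize_eqAxiom hψ
    · exact (condFrame_models_KM hA hσ).realize_of_mem ψ hψ
  refine ⟨τ, ?_, ?_, fun ψ hψ => ?_, fun ψ hψ => ?_⟩
  · refine Theory.models_sentence_iff.2 fun A => ?_
    rw [Sentence.Realize, Formula.realize_iExs]
    refine ⟨fun _ => Classical.arbitrary A, ?_⟩
    rw [Formula.realize_relabel, hpar]
    exact Formula.realize_top.2 trivial
  · refine Theory.models_formula_iff.2 fun A a => ?_
    rw [Formula.realize_imp, Translation.realize_domNonempty, hτ]
    obtain ⟨p⟩ := nonempty_cond A.is_model (hn := hn) (σ := σ)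
    exact fun _ => ⟨_, Or.inl (isWorld_iff.2 ⟨p, rfl⟩)⟩
  · refine Theory.models_formula_iff.2 fun A a => ?_
    rw [Formula.realize_imp]
    exact fun _ => key A.is_model a ψ (Or.inl hψ)
  · refine Theory.models_formula_iff.2 fun A a => ?_
    rw [Formula.realize_imp]
    exact fun _ => key A.is_model a ψ (Or.inr hψ)
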